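/- Let $(S,\mathfrak A,\mu)$ and $(T,\mathfrak B,\nu)$ be $\sigma$-finite measure spaces. A function $\Phi:S\times T\to\mathbb C$ belongs to $\mathfrak M(S\times T)$ (is a discrete Schur multiplier) if for every bounded linear operator $A:\ell^2(T)\to\ell^2(S)$ with matrix $\{a(s,t)\}_{(s,t)\in S\times T}$ the matrix $\{\Phi(s,t)a(s,t)\}_{(s,t)\in S\times T}$ is also the matrix of a bounded linear operator $M_\Phi A:\ell^2(T)\to\ell^2(S)$; $\|\Phi\|_{\mathfrak M(S\times T)}$ denotes the norm of the transformer $A\mapsto M_\Phi A$ with respect to the operator norms. For $h\in L^2(\mu\times\nu)$ let $\mathcal I_h:L^2(\nu)\to L^2(\mu)$ be the integral operator $(\mathcal I_hf)(s)=\int_T h(s,t)f(t)\,d\nu(t)$, and let $\|\cdot\|_{\boldsymbol S_1}$ be the trace norm, with $\|\mathcal I_h\|_{\boldsymbol S_1}=\infty$ if $\mathcal I_h$ is not of trace class (in particular if $h\notin L^2(\mu\times\nu)$). A $\mu\times\nu$-measurable function $\Phi:S\times T\to\mathbb C$ belongs to $\mathfrak M(\mu,\nu)$ if for every $h\in L^2(\mu\times\nu)$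 for which $\mathcal I_h$ is of trace class, $\mathcal I_{\Phi h}$ is of trace class; $\|\Phi\|_{\mathfrak M(\mu,\nu)}$ is the smallest constant $c\ge0$ such that $\|\mathcal I_{\Phi h}\|_{\boldsymbol S_1}\le c\,\|\mathcal I_h\|_{\boldsymbol S_1}$ for all $h\in L^2(\mu\times\nu)$. Let $\Phi\in\mathfrak M(S\times T)$ be measurable with respect to $\mu\times\nu$ (that is, equal $\mu\times\nu$-almost everywhere to an $\mathfrak A\otimes\mathfrak B$-measurable function). Then there are functions $\varphi_n\in L^\infty(\mu)$ and $\psi_n\in L^\infty(\nu)$, $n\ge1$, such that $$\Phi(s,t)=\sum_{n=1}^\infty\varphi_n(s)\psi_n(t)\quad\text{for }\mu\times\nu\text{-almost all }(s,t)\in S\times T,$$ $$\sum_{n=1}^\infty|\varphi_n|^2\le\|\Phi\|_{\mathfrak M(S\times T)}\quad\mu\text{-almost everywhere},\qquad \sum_{n=1}^\infty|\psi_n|^2\le\|\Phi\|_{\mathfrak M(S\times T)}\quad\nu\text{-almost everywhere}.$$ Moreover, $\Phi\in\mathfrak M(\mu,\nu)$ and $\|\Phi\|_{\mathfrak M(\mu,\nu)}\le\|\Phi\|_{\mathfrak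 M(S\times T)}$. -/

import Mathlib

open MeasureTheory
open scoped ENNReal InnerProductSpace

noncomputable section

namespace SchurMult

universe u v

/-! ### Discrete Schur multipliers -/

/-- The Hilbert space `ℓ²(X)` of square summable complex functions on an arbitrary set `X`. -/
abbrev EllTwo (X : Type u) : Type u := lp (fun _ : X => ℂ) 2

/-- The entry `a(s,t) = (A δ_t)(s)` of the matrix of an operator `A : ℓ²(T) → ℓ²(S)`. -/
def matrixEntry {S : Type u} {T : Type v} (A : EllTwo T →L[ℂ] EllTwo S) (s : S) (t : T) : ℂ :=
  letI := Classical.decEq T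
  (A (lp.single (E := fun _ : T => ℂ) 2 t (1 : ℂ)) : EllTwo S) s

/-- `B = M_Φ A`: the bounded operator `B` has the matrix `Φ(s,t) a(s,t)`,
where `a(s,t)` is the matrix of `A`. -/
def IsSchurProduct {S : Type u} {T : Type v} (Φ : S × T → ℂ)
    (A B : EllTwo T →L[ℂ] EllTwo S) : Prop :=
  ∀ s t, matrixEntry B s t = Φ (s, t) * matrixEntry A s t

/-- A bounded operator is determined by its matrix. -/
theorem matrixEntry_ext {S : Type u} {T : Type v} {A B : EllTwo T →L[ℂ] EllTwo S}
    (h : ∀ s t, matrixEntry A s t = matrixEntry B s t) : A = B := by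
  classical
  have key : ∀ t : T, ∀ c : ℂ, A (lp.single (E := fun _ : T => ℂ) 2 t c) =
      B (lp.single (E := fun _ : T => ℂ) 2 t c) := by
    intro t c
    have h1 : lp.single (E := fun _ : T => ℂ) 2 t c =
        c • lp.single (E := fun _ : T => ℂ) 2 t (1 : ℂ) := by
      rw [← lp.single_smul]; simp
    rw [h1, map_smul, map_smul]
    congr 1
    ext s
    have := h s t
    unfold matrixEntry at this
    convert this using 4
  ext1 f
  have hf := lp.hasSum_single (E := fun _ : T => ℂ) (p := 2) (by norm_num) f
  have hA := hf.mapL A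
  have hB := hf.mapL B
  simp only [key] at hA
  exact hA.unique hB

/-- Hence `M_Φ A` is unique. -/
theorem IsSchurProduct.unique {S : Type u} {T : Type v} {Φ : S × T → ℂ}
    {A B B' : EllTwo T →L[ℂ] EllTwo S} (h : IsSchurProduct Φ A B) (h' : IsSchurProduct Φ A B') :
    B = B' :=
  matrixEntry_ext fun s t => (h s t).trans (h' s t).symm

/-- `Φ ∈ 𝔐(S × T)`: for every bounded `A : ℓ²(T) → ℓ²(S)` the matrix `Φ(s,t) a(s,t)` is the matrix
of a bounded operator `ℓ²(T) → ℓ²(S)`. -/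
def IsDiscreteSchurMultiplier {S : Type u} {T : Type v} (Φ : S × T → ℂ) : Prop :=
  ∀ A : EllTwo T →L[ℂ] EllTwo S, ∃ B : EllTwo T →L[ℂ] EllTwo S, IsSchurProduct Φ A B

/-- `‖Φ‖_{𝔐(S × T)}`: the norm of the transformer `A ↦ M_Φ A`, that is, the least `c ≥ 0` such that
`‖M_Φ A‖ ≤ c ‖A‖` for all bounded `A`. -/
def discreteSchurNorm {S : Type u} {T : Type v} (Φ : S × T → ℂ) : ℝ :=
  sInf {c : ℝ | 0 ≤ c ∧ ∀ A B : EllTwo T →L[ℂ] EllTwo S, IsSchurProduct Φ A B → ‖B‖ ≤ c * ‖A‖}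

/-! ### Trace norm -/

section TraceNorm

variable {E : Type u} {F : Type v}
  [NormedAddCommGroup E] [InnerProductSpace ℂ E] [CompleteSpace E]
  [NormedAddCommGroup F] [InnerProductSpace ℂ F] [CompleteSpace F]

/-- `|A| = (A* A)^{1/2}` for a bounded operator between Hilbert spaces. -/
def opAbs (A : E →L[ℂ] F) : E →L[ℂ] E :=
  CFC.sqrt ((ContinuousLinearMap.adjoint A) ∘L A)

/-- The sum `∑ ⟨|A| e_i, e_i⟩ ∈ [0, ∞]` over a Hilbert basis `e`. -/
def traceNormOn {ι : Type*} (e : HilbertBasis ι ℂ E) (A : E →L[ℂ] F) : ℝ≥0∞ :=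
  ∑' i, ENNReal.ofReal (RCLike.re ⟪e i, opAbs A (e i)⟫_ℂ)

/-- The trace norm `‖A‖_{S₁} = tr |A| ∈ [0, ∞]`, computed in some Hilbert basis of the domain; it
does not depend on the basis, see `traceNorm_eq`. The operator `A` is of trace class if and only if
`‖A‖_{S₁} < ∞`. -/
def traceNorm (A : E →L[ℂ] F) : ℝ≥0∞ :=
  traceNormOn (exists_hilbertBasis ℂ E).choose_spec.choose A

theorem parseval_enorm {ι : Type*} (e : HilbertBasis ι ℂ E) (x : E) :
    ∑' i, ‖⟪e i, x⟫_ℂ‖ₑ ^ 2 = ‖x‖ₑ ^ 2 := by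
  have h := e.hasSum_inner_mul_inner x x
  have h2 : HasSum (fun i => ‖⟪e i, x⟫_ℂ‖ ^ 2) (‖x‖ ^ 2) := by
    have h3 := Complex.hasSum_re h
    convert h3 using 1
    · ext i
      rw [← inner_conj_symm x (e i), RCLike.conj_mul]
      norm_cast
    · rw [inner_self_eq_norm_sq_to_K]
      norm_cast
  have h4 := ENNReal.ofReal_tsum_of_nonneg (fun i => by positivity) h2.summable
  rw [h2.tsum_eq, ENNReal.ofReal_pow (norm_nonneg _), ofReal_norm] at h4
  rw [h4]
  refine tsum_congr fun i => ?_
  rw [ENNReal.ofReal_pow (norm_nonneg _), ofReal_norm]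

theorem traceNormOn_eq {ι κ : Type*} (e : HilbertBasis ι ℂ E) (f : HilbertBasis κ ℂ E)
    (A : E →L[ℂ] F) : traceNormOn e A = traceNormOn f A := by
  set Q : E →L[ℂ] E := CFC.sqrt (opAbs A) with hQ
  have hQQ : Q * Q = opAbs A := CFC.sqrt_mul_sqrt_self _ (CFC.sqrt_nonneg _)
  have hQsa : IsSelfAdjoint Q := (CFC.sqrt_nonneg (opAbs A)).isSelfAdjoint
  have hsym : ∀ x y : E, ⟪x, Q y⟫_ℂ = ⟪Q x, y⟫_ℂ := fun x y => by
    rw [← ContinuousLinearMap.adjoint_inner_left, hQsa.adjoint_eq]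
  have hterm : ∀ x : E, ENNReal.ofReal (RCLike.re ⟪x, opAbs A x⟫_ℂ) = ‖Q x‖ₑ ^ 2 := fun x => by
    rw [← hQQ, show (Q * Q) x = Q (Q x) from rfl, hsym, inner_self_eq_norm_sq,
      ENNReal.ofReal_pow (norm_nonneg _), ofReal_norm]
  unfold traceNormOn
  simp only [hterm]
  calc ∑' i, ‖Q (e i)‖ₑ ^ 2 = ∑' i, ∑' j, ‖⟪f j, Q (e i)⟫_ℂ‖ₑ ^ 2 := by
        simp only [parseval_enorm f]
    _ = ∑' j, ∑' i, ‖⟪f j, Q (e i)⟫_ℂ‖ₑ ^ 2 := ENNReal.tsum_comm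
    _ = ∑' j, ∑' i, ‖⟪e i, Q (f j)⟫_ℂ‖ₑ ^ 2 := by
        refine tsum_congr fun j => tsum_congr fun i => ?_
        rw [hsym, ← inner_conj_symm, RCLike.enorm_conj]
    _ = ∑' j, ‖Q (f j)‖ₑ ^ 2 := by simp only [parseval_enorm e]

/-- The trace norm may be computed in any Hilbert basis. -/
theorem traceNorm_eq {ι : Type*} (e : HilbertBasis ι ℂ E) (A : E →L[ℂ] F) :
    traceNorm A = ∑' i, ENNReal.ofReal (RCLike.re ⟪e i, opAbs A (e i)⟫_ℂ) :=
  traceNormOn_eq _ e A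

end TraceNorm

/-! ### Integral operators -/

section Integral

variable {S : Type u} {T : Type v} [MeasurableSpace S] [MeasurableSpace T]

theorem ae_memLp_section {μ : Measure S} {ν : Measure T} [SFinite μ] [SFinite ν] {h : S × T → ℂ}
    (hh : MemLp h 2 (μ.prod ν)) : ∀ᵐ s ∂μ, MemLp (fun t => h (s, t)) 2 ν := by
  have h1 : Integrable (fun z => ‖h z‖ ^ 2) (μ.prod ν) := (memLp_two_iff_integrable_sq_norm hh.1).1 hh
  filter_upwards [h1.prod_right_ae, hh.1.prodMk_left] with s hs hs'
  exact (memLp_two_iff_integrable_sq_norm hs').2 hs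

theorem eLpNorm_two_sq {X : Type*} [MeasurableSpace X] (m : Measure X) (g : X → ℂ) :
    eLpNorm g 2 m ^ 2 = ∫⁻ x, ‖g x‖ₑ ^ 2 ∂m := by
  rw [eLpNorm_eq_lintegral_rpow_enorm_toReal (by norm_num) (by norm_num)]
  rw [← ENNReal.rpow_natCast, ← ENNReal.rpow_mul]
  norm_num

theorem enorm_integral_mul_sq_le (m : Measure T) {g f : T → ℂ} (hg : AEStronglyMeasurable g m)
    (hf : AEStronglyMeasurable f m) :
    ‖∫ t, g t * f t ∂m‖ₑ ^ 2 ≤ (∫⁻ t, ‖g t‖ₑ ^ 2 ∂m) * eLpNorm f 2 m ^ 2 := by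
  have h1 : ‖∫ t, g t * f t ∂m‖ₑ ≤ eLpNorm g 2 m * eLpNorm f 2 m := by
    calc ‖∫ t, g t * f t ∂m‖ₑ ≤ ∫⁻ t, ‖g t * f t‖ₑ ∂m := enorm_integral_le_lintegral_enorm _
      _ = ∫⁻ t, ((fun t => ‖g t‖ₑ) * (fun t => ‖f t‖ₑ)) t ∂m := by simp [enorm_mul]
      _ ≤ _ := ENNReal.lintegral_mul_le_Lp_mul_Lq m Real.HolderConjugate.two_two hg.enorm hf.enorm
      _ = _ := by
        rw [eLpNorm_eq_lintegral_rpow_enorm_toReal (by norm_num) (by norm_num),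
          eLpNorm_eq_lintegral_rpow_enorm_toReal (by norm_num) (by norm_num)]
        simp
  calc _ ≤ (eLpNorm g 2 m * eLpNorm f 2 m) ^ 2 := by gcongr
    _ = _ := by rw [mul_pow, eLpNorm_two_sq m g]

theorem eLpNorm_kernel_le {μ : Measure S} {ν : Measure T} [SFinite μ] [SFinite ν] {h : S × T → ℂ}
    (hh : MemLp h 2 (μ.prod ν)) {f : T → ℂ} (hf : MemLp f 2 ν) :
    eLpNorm (fun s => ∫ t, h (s, t) * f t ∂ν) 2 μ ≤ eLpNorm h 2 (μ.prod ν) * eLpNorm f 2 ν := by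
  rw [← ENNReal.pow_le_pow_left_iff two_ne_zero, mul_pow, eLpNorm_two_sq, eLpNorm_two_sq (μ.prod ν),
    lintegral_prod _ (hh.1.enorm.pow_const 2)]
  calc _ ≤ ∫⁻ s, (∫⁻ t, ‖h (s, t)‖ₑ ^ 2 ∂ν) * eLpNorm f 2 ν ^ 2 ∂μ := by
        refine lintegral_mono_ae ?_
        filter_upwards [hh.1.prodMk_left] with s hs
        exact enorm_integral_mul_sq_le ν hs hf.1
    _ = _ := lintegral_mul_const'' _ (hh.1.enorm.pow_const 2).lintegral_prod_right'

theorem memLp_kernel {μ : Measure S} {ν : Measure T} [SFinite μ] [SFinite ν] {h : S × T → ℂ}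
    (hh : MemLp h 2 (μ.prod ν)) {f : T → ℂ} (hf : MemLp f 2 ν) :
    MemLp (fun s => ∫ t, h (s, t) * f t ∂ν) 2 μ :=
  ⟨(hh.1.mul hf.1.comp_snd).integral_prod_right',
    (eLpNorm_kernel_le hh hf).trans_lt (ENNReal.mul_lt_top hh.2 hf.2)⟩

/-- The integral operator `I_h : L²(ν) → L²(μ)`, `(I_h f)(s) = ∫ h(s,t) f(t) dν(t)`, with a kernel
`h ∈ L²(μ × ν)`. -/
def integralOperator (μ : Measure S) (ν : Measure T) [SFinite μ] [SFinite ν] (h : S × T → ℂ)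
    (hh : MemLp h 2 (μ.prod ν)) : Lp ℂ 2 ν →L[ℂ] Lp ℂ 2 μ :=
  LinearMap.mkContinuous
    { toFun := fun f => (memLp_kernel hh (Lp.memLp f)).toLp (fun s => ∫ t, h (s, t) * f t ∂ν)
      map_add' := fun f g => by
        rw [← MemLp.toLp_add]
        refine MemLp.toLp_congr _ _ ?_
        filter_upwards [ae_memLp_section hh] with s hs
        simp only [Pi.add_apply]
        refine Eq.trans ?_ (integral_add (hs.integrable_mul (Lp.memLp f))
          (hs.integrable_mul (Lp.memLp g)))
        refine integral_congr_ae ?_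
        filter_upwards [Lp.coeFn_add f g] with t ht
        simp only [ht, Pi.add_apply, mul_add]
      map_smul' := fun c f => by
        rw [RingHom.id_apply, ← MemLp.toLp_const_smul]
        refine MemLp.toLp_congr _ _ (Filter.Eventually.of_forall fun s => ?_)
        simp only [Pi.smul_apply]
        rw [← integral_smul]
        refine integral_congr_ae ?_
        filter_upwards [Lp.coeFn_smul c f] with t ht
        simp only [ht, Pi.smul_apply, smul_eq_mul]
        ring }
    (eLpNorm h 2 (μ.prod ν)).toReal
    (fun f => by
      simp only [LinearMap.coe_mk, AddHom.coe_mk]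
      rw [Lp.norm_toLp, Lp.norm_def, ← ENNReal.toReal_mul]
      exact ENNReal.toReal_mono (ENNReal.mul_lt_top hh.2 (Lp.memLp f).2).ne
        (eLpNorm_kernel_le hh (Lp.memLp f)))

theorem integralOperator_apply (μ : Measure S) (ν : Measure T) [SFinite μ] [SFinite ν]
    (h : S × T → ℂ) (hh : MemLp h 2 (μ.prod ν)) (f : Lp ℂ 2 ν) :
    integralOperator μ ν h hh f =ᵐ[μ] fun s => ∫ t, h (s, t) * f t ∂ν :=
  MemLp.coeFn_toLp (memLp_kernel hh (Lp.memLp f))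

/-! ### Schur multipliers with respect to measures -/

open Classical in
/-- `‖I_h‖_{S₁} ∈ [0, ∞]`, which is `∞` when `I_h` is not of trace class; in particular it is `∞`
when `h ∉ L²(μ × ν)`. -/
def kernelTraceNorm (μ : Measure S) (ν : Measure T) [SFinite μ] [SFinite ν] (h : S × T → ℂ) :
    ℝ≥0∞ :=
  if hh : MemLp h 2 (μ.prod ν) then traceNorm (integralOperator μ ν h hh) else ∞

/-- `Φ ∈ 𝔐(μ, ν)`: the function `Φ` is `μ × ν`-measurable, and if `h ∈ L²(μ × ν)` and `I_h` is of
trace class, then `I_{Φ h}` is of trace class. -/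
def IsSchurMultiplier (μ : Measure S) (ν : Measure T) [SFinite μ] [SFinite ν] (Φ : S × T → ℂ) :
    Prop :=
  AEMeasurable Φ (μ.prod ν) ∧ ∀ h : S × T → ℂ, MemLp h 2 (μ.prod ν) →
    kernelTraceNorm μ ν h < ∞ → kernelTraceNorm μ ν (fun z => Φ z * h z) < ∞

/-- `‖Φ‖_{𝔐(μ, ν)}`: the least `c` with `‖I_{Φ h}‖_{S₁} ≤ c ‖I_h‖_{S₁}` for all `h ∈ L²(μ × ν)`
(with the value `∞` if there is no finite `c`). -/
def schurNorm (μ : Measure S) (ν : Measure T) [SFinite μ] [SFinite ν] (Φ : S × T → ℂ) : ℝ≥0∞ :=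
  sInf {c : ℝ≥0∞ | ∀ h : S × T → ℂ, MemLp h 2 (μ.prod ν) →
    kernelTraceNorm μ ν (fun z => Φ z * h z) ≤ c * kernelTraceNorm μ ν h}

end Integral

end SchurMult

end

noncomputable section

namespace SchurMult

universe u v

/-! ### Boundedness of the discrete transformer -/

/-! Write c for the discrete norm of Φ. By the closed graph theorem the transformer is bounded, so
every finite matrix Φ(s_i, t_j) with distinct s_i and distinct t_j is a Schur multiplier of norm at
most c. This bound survives averaging: if s_i and t_j are drawn independently from disjoint sets A_i
and disjoint sets B_j, the means of Φ over A_i × B_j again form such a matrix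
(`isSchurBounded_average`). From there on only averages of Φ matter.

For finite matrices, Hahn–Banach duality (`IsSchurBounded.mem_closure`) yields vectors of squared
norm at most c + ε whose inner products reproduce the entries up to ε. Used as coefficients of step
kernels, they define positive operators on L²(ρ), where ρ is a finite measure on a disjoint union of
models of S and T. A weak limit K over finer and finer families of sets satisfies ⟨K 1_E, 1_E⟩ ≤ c
ρ(E)² for all E, and ⟨K 1_E, 1_G⟩ is the integral of the kernel over E × G for E on the S side and G
on the T side (`HasSchurAverages.exists_positive_operator`). Applying the square root of K to an
orthonormal basis gives functions χ_n. The first property forces ∑ |χ_n|² ≤ c almost everywhere, the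
second identifies Φ with ∑ χ_n(s) conj χ_n(t).

A sequence χ_n suffices only if L²(ρ) is separable. This is arranged by factoring Φ, up to a null
set, through Cantor spaces (`exists_measurable_factorization`). Infinite measures are replaced by
equivalent finite ones.

For the trace norm, the factorization gives I_{Φh} = ∑ M_{φ_n} I_h M_{ψ_n} weakly, and polar
decomposition with Cauchy–Schwarz for Hilbert–Schmidt norms gives the constant c
(`traceNorm_le_of_hasSum`). -/

theorem matrixEntry_add {S : Type u} {T : Type v} (A B : EllTwo T →L[ℂ] EllTwo S) (s : S) (t : T) :
    matrixEntry (A + B) s t = matrixEntry A s t + matrixEntry B s t := rfl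

theorem matrixEntry_smul {S : Type u} {T : Type v} (c : ℂ) (A : EllTwo T →L[ℂ] EllTwo S)
    (s : S) (t : T) : matrixEntry (c • A) s t = c * matrixEntry A s t := rfl

theorem continuous_matrixEntry {S : Type u} {T : Type v} (s : S) (t : T) :
    Continuous fun A : EllTwo T →L[ℂ] EllTwo S => matrixEntry A s t := by
  classical
  unfold matrixEntry
  have h1 : Continuous fun f : EllTwo S => (f : S → ℂ) s :=
    (lp.evalCLM ℂ (fun _ : S => ℂ) 2 s).continuous
  exact h1.comp (ContinuousLinearMap.apply ℂ (EllTwo S) _).continuous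

/-- The transformer `A ↦ M_Φ A`. -/
def schurTransformer {S : Type u} {T : Type v} {Φ : S × T → ℂ}
    (hΦ : IsDiscreteSchurMultiplier Φ) :
    (EllTwo T →L[ℂ] EllTwo S) →ₗ[ℂ] (EllTwo T →L[ℂ] EllTwo S) where
  toFun A := (hΦ A).choose
  map_add' A B := (hΦ (A + B)).choose_spec.unique fun s t => by
    rw [matrixEntry_add, matrixEntry_add, (hΦ A).choose_spec s t, (hΦ B).choose_spec s t, mul_add]
  map_smul' c A := (hΦ (c • A)).choose_spec.unique fun s t => by
    rw [RingHom.id_apply, matrixEntry_smul, matrixEntry_smul, (hΦ A).choose_spec s t]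
    ring

theorem isSchurProduct_schurTransformer {S : Type u} {T : Type v} {Φ : S × T → ℂ}
    (hΦ : IsDiscreteSchurMultiplier Φ) (A : EllTwo T →L[ℂ] EllTwo S) :
    IsSchurProduct Φ A (schurTransformer hΦ A) :=
  (hΦ A).choose_spec

/-- Closed graph theorem: matrix entries are continuous in the operator and determine it. -/
theorem continuous_schurTransformer {S : Type u} {T : Type v} {Φ : S × T → ℂ}
    (hΦ : IsDiscreteSchurMultiplier Φ) : Continuous (schurTransformer hΦ) := by
  refine LinearMap.continuous_of_seq_closed_graph _ fun a A B ha hB => ?_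
  refine IsSchurProduct.unique (Φ := Φ) (A := A) (fun s t => ?_)
    (isSchurProduct_schurTransformer hΦ A)
  have h1 := ((continuous_matrixEntry s t).tendsto B).comp hB
  have h2 := (((continuous_matrixEntry s t).tendsto A).comp ha).const_mul (Φ (s, t))
  refine tendsto_nhds_unique h1 (h2.congr fun n => ?_)
  exact (isSchurProduct_schurTransformer hΦ (a n) s t).symm

theorem discreteSchurNorm_nonneg {S : Type u} {T : Type v} (Φ : S × T → ℂ) :
    0 ≤ discreteSchurNorm Φ :=
  Real.sInf_nonneg fun _ h => h.1

theorem IsSchurProduct.norm_le {S : Type u} {T : Type v} {Φ : S × T → ℂ}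
    (hΦ : IsDiscreteSchurMultiplier Φ) {A B : EllTwo T →L[ℂ] EllTwo S}
    (h : IsSchurProduct Φ A B) : ‖B‖ ≤ discreteSchurNorm Φ * ‖A‖ := by
  set L : (EllTwo T →L[ℂ] EllTwo S) →L[ℂ] (EllTwo T →L[ℂ] EllTwo S) :=
    ⟨schurTransformer hΦ, continuous_schurTransformer hΦ⟩ with hL
  -- Boundedness of the transformer is needed here: the real infimum of an empty set would be 0.
  have hne : {c : ℝ | 0 ≤ c ∧ ∀ A B : EllTwo T →L[ℂ] EllTwo S, IsSchurProduct Φ A B →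
      ‖B‖ ≤ c * ‖A‖}.Nonempty := by
    refine ⟨‖L‖, L.opNorm_nonneg, fun A B hAB => ?_⟩
    rw [hAB.unique (isSchurProduct_schurTransformer hΦ A)]
    exact L.le_opNorm A
  rcases (norm_nonneg A).eq_or_lt with hA | hA
  · obtain ⟨c, -, hc⟩ := hne
    have := hc A B h
    rw [← hA] at this ⊢
    simpa using this
  · rw [← div_le_iff₀ hA]
    refine le_csInf hne fun c hc => ?_
    rw [div_le_iff₀ hA]
    exact hc.2 A B h

theorem inner_single_one {X : Type u} [DecidableEq X] (x : X) (f : EllTwo X) :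
    ⟪lp.single (E := fun _ : X => ℂ) 2 x (1 : ℂ), f⟫_ℂ = f x := by
  rw [lp.inner_single_left]
  simp

theorem orthonormal_single {ι : Type*} {X : Type u} [DecidableEq X] {s : ι → X}
    (hs : Function.Injective s) :
    Orthonormal ℂ fun i => lp.single (E := fun _ : X => ℂ) 2 (s i) (1 : ℂ) := by
  classical
  rw [orthonormal_iff_ite]
  intro i j
  rw [inner_single_one, lp.single_apply]
  simp [Pi.single_apply, hs.eq_iff]

/-! ### Finite Schur multipliers -/

section Finite

variable {ι κ : Type*} [Fintype ι] [Fintype κ]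

/-- The matrix `a` defines a contraction between finite dimensional Hilbert spaces. -/
def IsMatrixContraction (a : ι → κ → ℂ) : Prop :=
  ∀ (z : ι → ℂ) (w : κ → ℂ), ∑ i, ‖z i‖ ^ 2 ≤ 1 → ∑ j, ‖w j‖ ^ 2 ≤ 1 →
    ‖∑ i, ∑ j, a i j * z i * w j‖ ≤ 1

/-- The matrix `M` is a Schur multiplier of norm at most `c`. -/
def IsSchurBounded (c : ℝ) (M : ι → κ → ℂ) : Prop :=
  ∀ a : ι → κ → ℂ, IsMatrixContraction a → ∀ (z : ι → ℂ) (w : κ → ℂ),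
    ‖∑ i, ∑ j, M i j * a i j * z i * w j‖ ≤ c / 2 * (∑ i, ‖z i‖ ^ 2 + ∑ j, ‖w j‖ ^ 2)

theorem IsMatrixContraction.norm_le {a : ι → κ → ℂ} (ha : IsMatrixContraction a)
    {r q : ℝ} (hr : 0 < r) (hq : 0 < q)
    {z : ι → ℂ} {w : κ → ℂ} (hz : ∑ i, ‖z i‖ ^ 2 ≤ r ^ 2) (hw : ∑ j, ‖w j‖ ^ 2 ≤ q ^ 2) :
    ‖∑ i, ∑ j, a i j * z i * w j‖ ≤ r * q := by
  have h := ha (fun i => z i / r) (fun j => w j / q)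
    (by simpa [div_pow, ← Finset.sum_div] using div_le_one_of_le₀ hz (by positivity))
    (by simpa [div_pow, ← Finset.sum_div] using div_le_one_of_le₀ hw (by positivity))
  have h2 : ∑ i, ∑ j, a i j * (z i / r) * (w j / q) =
      (∑ i, ∑ j, a i j * z i * w j) / (r * q : ℝ) := by
    rw [Finset.sum_div]
    refine Finset.sum_congr rfl fun i _ => ?_
    rw [Finset.sum_div]
    refine Finset.sum_congr rfl fun j _ => ?_
    push_cast
    field_simp
  rw [h2, norm_div, Complex.norm_real, Real.norm_of_nonneg (by positivity),
    div_le_one (by positivity)] at h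
  exact h

open Classical in
/-- The vector of `ℓ²` with coefficients `z` at the points `s`. -/
def pointVector {X : Type u} (s : ι → X) (z : ι → ℂ) : EllTwo X :=
  ∑ i, z i • lp.single (E := fun _ : X => ℂ) 2 (s i) (1 : ℂ)

theorem norm_pointVector_sq {X : Type u} {s : ι → X} (hs : Function.Injective s) (z : ι → ℂ) :
    ‖pointVector s z‖ ^ 2 = ∑ i, ‖z i‖ ^ 2 := by
  classical
  have h := (orthonormal_single hs).inner_sum z z Finset.univ
  have h2 : ⟪pointVector s z, pointVector s z⟫_ℂ = ((∑ i, ‖z i‖ ^ 2 : ℝ) : ℂ) := by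
    unfold pointVector
    convert h using 1
    push_cast
    exact Finset.sum_congr rfl fun i _ => by rw [Complex.conj_mul']
  rw [inner_self_eq_norm_sq_to_K] at h2
  exact Complex.ofReal_injective ((Complex.ofReal_pow _ _).trans h2)

theorem sum_norm_apply_sq_le {X : Type u} {s : ι → X} (hs : Function.Injective s) (f : EllTwo X) :
    ∑ i, ‖f (s i)‖ ^ 2 ≤ ‖f‖ ^ 2 := by
  classical
  have h := (orthonormal_single hs).sum_inner_products_le f (s := Finset.univ)
  simpa only [inner_single_one] using h

theorem inner_pointVector {X : Type u} (s : ι → X) (z : ι → ℂ) (f : EllTwo X) :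
    ⟪pointVector s z, f⟫_ℂ = ∑ i, star (z i) * f (s i) := by
  classical
  unfold pointVector
  rw [sum_inner]
  refine Finset.sum_congr rfl fun i _ => ?_
  rw [inner_smul_left, inner_single_one]
  rfl

open Classical in
/-- The operator with matrix `a` at the points `s`, `t`. -/
def pointOperator {S : Type u} {T : Type v} (s : ι → S) (t : κ → T) (a : ι → κ → ℂ) :
    EllTwo T →L[ℂ] EllTwo S :=
  ∑ j, (innerSL ℂ (lp.single (E := fun _ : T => ℂ) 2 (t j) (1 : ℂ))).smulRight
    (pointVector s fun i => a i j)

theorem pointVector_apply {X : Type u} {s : ι → X} (hs : Function.Injective s) (z : ι → ℂ) (i : ι) :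
    pointVector s z (s i) = z i := by
  classical
  have h := (orthonormal_single hs).inner_right_fintype z i
  rw [inner_single_one] at h
  exact h

theorem pointOperator_apply {S : Type u} {T : Type v} (s : ι → S) (t : κ → T) (a : ι → κ → ℂ)
    (f : EllTwo T) : pointOperator s t a f = ∑ j, f (t j) • pointVector s fun i => a i j := by
  classical
  simp only [pointOperator, sum_apply, ContinuousLinearMap.smulRight_apply,
    innerSL_apply_apply, inner_single_one]

theorem matrixEntry_pointOperator {S : Type u} {T : Type v} {s : ι → S} {t : κ → T}
    (hs : Function.Injective s) (ht : Function.Injective t) (a : ι → κ → ℂ) (i : ι) (j : κ) :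
    matrixEntry (pointOperator s t a) (s i) (t j) = a i j := by
  classical
  unfold matrixEntry
  rw [pointOperator_apply, Finset.sum_eq_single j]
  · rw [lp.single_apply, Pi.single_eq_same, one_smul, pointVector_apply hs]
  · intro k _ hk
    rw [lp.single_apply, Pi.single_eq_of_ne (ht.ne hk), zero_smul]
  · simp

/-- With g the image of f, ‖g‖² = ⟨g, g⟩ is the bilinear form of `a` at the values of conj g and f,
hence at most ‖g‖ ‖f‖. -/
theorem norm_pointOperator_le {S : Type u} {T : Type v} {s : ι → S} {t : κ → T}
    (hs : Function.Injective s) (ht : Function.Injective t) {a : ι → κ → ℂ}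
    (ha : IsMatrixContraction a) : ‖pointOperator s t a‖ ≤ 1 := by
  refine ContinuousLinearMap.opNorm_le_bound _ zero_le_one fun f => ?_
  rw [one_mul]
  set g := pointOperator s t a f with hg
  rcases (norm_nonneg g).eq_or_lt with h0 | h0
  · rw [← h0]; exact norm_nonneg _
  rcases (norm_nonneg f).eq_or_lt with h1 | h1
  · rw [norm_eq_zero.1 h1.symm, map_zero] at hg
    simp [hg]
  have h2 : ⟪g, g⟫_ℂ = ∑ i, ∑ j, a i j * star (g (s i)) * f (t j) := by
    nth_rw 2 [hg]
    rw [pointOperator_apply, inner_sum, Finset.sum_comm]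
    refine Finset.sum_congr rfl fun j _ => ?_
    rw [inner_smul_right, ← inner_conj_symm, inner_pointVector, map_sum, Finset.mul_sum]
    refine Finset.sum_congr rfl fun i _ => ?_
    simp
    ring
  have h3 := ha.norm_le h0 h1 (z := fun i => star (g (s i))) (w := fun j => f (t j))
    (by simpa using sum_norm_apply_sq_le hs g) (sum_norm_apply_sq_le ht f)
  rw [← h2, inner_self_eq_norm_sq_to_K] at h3
  simp only [norm_pow, Complex.coe_algebraMap, Complex.norm_real, norm_norm] at h3
  nlinarith

/-- The contraction `a` is planted on the chosen points as an operator on ℓ², multiplied by Φ, and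
read off against finitely supported vectors. The arithmetic-geometric mean inequality turns c‖z‖‖w‖
into the additive form. -/
theorem isSchurBounded_of_injective {S : Type u} {T : Type v} {Φ : S × T → ℂ}
    (hΦ : IsDiscreteSchurMultiplier Φ) {s : ι → S} {t : κ → T}
    (hs : Function.Injective s) (ht : Function.Injective t) :
    IsSchurBounded (discreteSchurNorm Φ) fun i j => Φ (s i, t j) := by
  classical
  intro a ha z w
  obtain ⟨B, hB⟩ := hΦ (pointOperator s t a)
  have hBn : ‖B‖ ≤ discreteSchurNorm Φ := (hB.norm_le hΦ).trans
    (mul_le_of_le_one_right (discreteSchurNorm_nonneg Φ) (norm_pointOperator_le hs ht ha))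
  have h1 : ∑ i, ∑ j, Φ (s i, t j) * a i j * z i * w j =
      ⟪pointVector s fun i => star (z i), B (pointVector t w)⟫_ℂ := by
    rw [inner_pointVector]
    refine Finset.sum_congr rfl fun i _ => ?_
    have h2 : B (pointVector t w) (s i) = ∑ j, w j * matrixEntry B (s i) (t j) := by
      unfold pointVector matrixEntry
      rw [map_sum, lp.coeFn_sum, Finset.sum_apply]
      refine Finset.sum_congr rfl fun j _ => ?_
      rw [map_smul, lp.coeFn_smul, Pi.smul_apply, smul_eq_mul]
    rw [h2, Finset.mul_sum]
    refine Finset.sum_congr rfl fun j _ => ?_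
    rw [hB, matrixEntry_pointOperator hs ht, star_star]
    ring
  rw [h1]
  have hz := norm_pointVector_sq hs fun i => star (z i)
  simp only [norm_star] at hz
  rw [← hz, ← norm_pointVector_sq ht w]
  have h3 := norm_inner_le_norm (𝕜 := ℂ) (pointVector s fun i => star (z i)) (B (pointVector t w))
  have h4 := B.le_opNorm (pointVector t w)
  have h5 := mul_le_mul_of_nonneg_right hBn (norm_nonneg (pointVector t w))
  have h6 : ‖(pointVector s fun i => star (z i))‖ * ‖B (pointVector t w)‖ ≤
      ‖(pointVector s fun i => star (z i))‖ * (discreteSchurNorm Φ * ‖pointVector t w‖) :=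
    mul_le_mul_of_nonneg_left (h4.trans h5) (norm_nonneg _)
  nlinarith [mul_nonneg (discreteSchurNorm_nonneg Φ)
    (sq_nonneg (‖(pointVector s fun i => star (z i))‖ - ‖pointVector t w‖))]

end Finite

/-! ### Gram factorization of finite Schur multipliers by convex duality -/

section Gram

open scoped ComplexOrder

variable {ι κ : Type*} [Fintype ι] [Fintype κ]

open scoped MatrixOrder Matrix.Norms.L2Operator in
/-- A positive semidefinite matrix is a Gram matrix. -/
theorem exists_gram_vectors {n : Type*} [Fintype n] {X : Matrix n n ℂ} (hX : X.PosSemidef) :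
    ∃ x : n → EuclideanSpace ℂ n, ∀ k l, ⟪x k, x l⟫_ℂ = X k l := by
  classical
  obtain ⟨B, hB⟩ := CStarAlgebra.nonneg_iff_eq_star_mul_self.1 (Matrix.nonneg_iff_posSemidef.2 hX)
  refine ⟨fun k => WithLp.toLp 2 fun m => B m k, fun k l => ?_⟩
  rw [hB, Matrix.mul_apply, PiLp.inner_apply]
  refine Finset.sum_congr rfl fun m _ => ?_
  simp [Matrix.star_apply, mul_comm]

/-- Triples `(d, e, N)` such that some positive semidefinite matrix has off-diagonal block `N` and
diagonal entries at most `d` and `e`. -/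
def posSemidefCompletions (ι κ : Type*) [Fintype ι] [Fintype κ] :
    Set ((ι → ℂ) × (κ → ℂ) × (ι → κ → ℂ)) :=
  {x | ∃ X : Matrix (ι ⊕ κ) (ι ⊕ κ) ℂ, X.PosSemidef ∧
    (∀ i, (X (.inl i) (.inl i)).re ≤ (x.1 i).re) ∧ (∀ j, (X (.inr j) (.inr j)).re ≤ (x.2.1 j).re) ∧
    ∀ i j, X (.inl i) (.inr j) = x.2.2 i j}

theorem smul_mem_posSemidefCompletions {x : (ι → ℂ) × (κ → ℂ) × (ι → κ → ℂ)}
    (hx : x ∈ posSemidefCompletions ι κ) {r : ℝ} (hr : 0 ≤ r) :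
    r • x ∈ posSemidefCompletions ι κ := by
  obtain ⟨X, hX, h1, h2, h3⟩ := hx
  refine ⟨r • X, hX.smul hr, fun i => ?_, fun j => ?_, fun i j => ?_⟩
  · simpa using mul_le_mul_of_nonneg_left (h1 i) hr
  · simpa using mul_le_mul_of_nonneg_left (h2 j) hr
  · simp [h3 i j]

theorem convex_posSemidefCompletions : Convex ℝ (posSemidefCompletions ι κ) := by
  intro x hx y hy a b ha hb _
  obtain ⟨X, hX, h1, h2, h3⟩ := smul_mem_posSemidefCompletions hx ha
  obtain ⟨Y, hY, h1', h2', h3'⟩ := smul_mem_posSemidefCompletions hy hb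
  refine ⟨X + Y, hX.add hY, fun i => ?_, fun j => ?_, fun i j => ?_⟩
  · simpa using add_le_add (h1 i) (h1' i)
  · simpa using add_le_add (h2 j) (h2' j)
  · simpa using congrArg₂ (· + ·) (h3 i j) (h3' i j)

/-- The rank one matrix v v* with v = (z, conj w); the conjugate makes the off-diagonal block
bilinear in z and w. -/
theorem mem_posSemidefCompletions (z : ι → ℂ) (w : κ → ℂ) :
    ((fun i => ((‖z i‖ ^ 2 : ℝ) : ℂ), fun j => ((‖w j‖ ^ 2 : ℝ) : ℂ), fun i j => z i * w j) :
      (ι → ℂ) × (κ → ℂ) × (ι → κ → ℂ)) ∈ posSemidefCompletions ι κ := by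
  refine ⟨_, Matrix.posSemidef_vecMulVec_self_star (Sum.elim z fun j => star (w j)),
    fun i => ?_, fun j => ?_, fun i j => ?_⟩
  · simp only [Matrix.vecMulVec_apply, Sum.elim_inl, Pi.star_apply, Complex.ofReal_re]
    rw [Complex.star_def, Complex.mul_conj']
    exact_mod_cast le_rfl
  · simp only [Matrix.vecMulVec_apply, Sum.elim_inr, Pi.star_apply, Complex.ofReal_re, star_star]
    rw [Complex.star_def, Complex.conj_mul']
    exact_mod_cast le_rfl
  · simp [Matrix.vecMulVec_apply]

theorem diagonal_mem_posSemidefCompletions {d : ι → ℝ} {e : κ → ℝ} (hd : ∀ i, 0 ≤ d i)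
    (he : ∀ j, 0 ≤ e j) :
    ((fun i => (d i : ℂ), fun j => (e j : ℂ), 0) : (ι → ℂ) × (κ → ℂ) × (ι → κ → ℂ)) ∈
      posSemidefCompletions ι κ :=
  ⟨0, Matrix.PosSemidef.zero, by simpa using hd, by simpa using he, by simp⟩

/-- A functional nonnegative on `posSemidefCompletions` is bounded below at Schur multipliers. -/
theorem IsSchurBounded.functional_nonneg {c : ℝ} (hc : 0 ≤ c) {M : ι → κ → ℂ}
    (hM : IsSchurBounded c M) {α : ι → ℝ} {β : κ → ℝ} {b : ι → κ → ℂ} (hα : ∀ i, 0 ≤ α i)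
    (hβ : ∀ j, 0 ≤ β j)
    (h : ∀ (z : ι → ℂ) (w : κ → ℂ), 0 ≤ ∑ i, α i * ‖z i‖ ^ 2 + ∑ j, β j * ‖w j‖ ^ 2 +
      (∑ i, ∑ j, b i j * (z i * w j)).re) :
    0 ≤ ∑ i, α i * c + ∑ j, β j * c + (∑ i, ∑ j, b i j * M i j).re := by
  have h1 : ∀ (z : ι → ℂ) (w : κ → ℂ), ‖∑ i, ∑ j, b i j * z i * w j‖ ≤
      ∑ i, α i * ‖z i‖ ^ 2 + ∑ j, β j * ‖w j‖ ^ 2 := by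
    intro z w
    set y := ∑ i, ∑ j, b i j * z i * w j with hy
    -- Rotating z by a phase leaves the diagonal terms unchanged and turns the real part into minus
    -- the modulus.
    obtain ⟨u, hu, huy⟩ : ∃ u : ℂ, ‖u‖ = 1 ∧ u * y = -(‖y‖ : ℂ) := by
      rcases eq_or_ne y 0 with h0 | h0
      · exact ⟨1, by simp, by simp [h0]⟩
      · refine ⟨-(‖y‖ / y), by simp [h0], by field_simp⟩
    have h2 := h (fun i => u * z i) w
    have h3 : ∑ i, ∑ j, b i j * (u * z i * w j) = u * y := by
      rw [hy, Finset.mul_sum]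
      refine Finset.sum_congr rfl fun i _ => ?_
      rw [Finset.mul_sum]
      exact Finset.sum_congr rfl fun j _ => by ring
    simp only [h3, huy, norm_mul, hu, one_mul, Complex.neg_re, Complex.ofReal_re] at h2
    linarith
  have h2 : ∀ δ : ℝ, 0 < δ → -(∑ i, α i * c + ∑ j, β j * c + (∑ i, ∑ j, b i j * M i j).re) ≤
      δ * (c * (Fintype.card ι + Fintype.card κ)) := by
    intro δ hδ
    -- Rescaling by the square roots of the weights makes b / (2 r q) a contraction: the factor 2
    -- absorbs ‖z‖² + ‖w‖² ≤ 2. The shift by δ keeps the weights positive. Testing the multiplier at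
    -- z = r, w = q then recovers ∑ b M.
    set r : ι → ℝ := fun i => √(α i + δ)
    set q : κ → ℝ := fun j => √(β j + δ)
    have hr : ∀ i, 0 < r i := fun i => Real.sqrt_pos.2 (by linarith [hα i])
    have hq : ∀ j, 0 < q j := fun j => Real.sqrt_pos.2 (by linarith [hβ j])
    have hr2 : ∀ i, r i ^ 2 = α i + δ := fun i => Real.sq_sqrt (by linarith [hα i])
    have hq2 : ∀ j, q j ^ 2 = β j + δ := fun j => Real.sq_sqrt (by linarith [hβ j])
    have ha : IsMatrixContraction fun i j => b i j / (2 * r i * q j) := by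
      intro z w hz hw
      have h3 := h1 (fun i => z i / r i) (fun j => w j / q j)
      have h4 : ∑ i, ∑ j, b i j / (2 * r i * q j) * z i * w j =
          (∑ i, ∑ j, b i j * (z i / r i) * (w j / q j)) / 2 := by
        rw [Finset.sum_div]
        refine Finset.sum_congr rfl fun i _ => ?_
        rw [Finset.sum_div]
        refine Finset.sum_congr rfl fun j _ => ?_
        have := (Complex.ofReal_ne_zero.2 (hr i).ne')
        have := (Complex.ofReal_ne_zero.2 (hq j).ne')
        field_simp
      have h5 : ∑ i, α i * ‖z i / r i‖ ^ 2 ≤ ∑ i, ‖z i‖ ^ 2 := by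
        refine Finset.sum_le_sum fun i _ => ?_
        rw [norm_div, div_pow, Complex.norm_real, Real.norm_of_nonneg (hr i).le, hr2,
          mul_div_assoc', div_le_iff₀ (by linarith [hα i])]
        nlinarith [sq_nonneg ‖z i‖]
      have h6 : ∑ j, β j * ‖w j / q j‖ ^ 2 ≤ ∑ j, ‖w j‖ ^ 2 := by
        refine Finset.sum_le_sum fun j _ => ?_
        rw [norm_div, div_pow, Complex.norm_real, Real.norm_of_nonneg (hq j).le, hq2,
          mul_div_assoc', div_le_iff₀ (by linarith [hβ j])]
        nlinarith [sq_nonneg ‖w j‖]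
      rw [h4, norm_div, Complex.norm_ofNat]
      linarith
    have h3 := hM _ ha (fun i => r i) (fun j => q j)
    have h4 : ∑ i, ∑ j, M i j * (b i j / (2 * r i * q j)) * r i * q j =
        (∑ i, ∑ j, b i j * M i j) / 2 := by
      rw [Finset.sum_div]
      refine Finset.sum_congr rfl fun i _ => ?_
      rw [Finset.sum_div]
      refine Finset.sum_congr rfl fun j _ => ?_
      have := (Complex.ofReal_ne_zero.2 (hr i).ne')
      have := (Complex.ofReal_ne_zero.2 (hq j).ne')
      field_simp
    simp only [h4, norm_div, Complex.norm_ofNat, Complex.norm_real,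
      Real.norm_eq_abs, sq_abs, hr2, hq2, Finset.sum_add_distrib, Finset.sum_const,
      Finset.card_univ, nsmul_eq_mul] at h3
    have h5 := (Complex.abs_re_le_norm (∑ i, ∑ j, b i j * M i j))
    rw [← Finset.sum_mul, ← Finset.sum_mul]
    linarith [neg_abs_le (∑ i, ∑ j, b i j * M i j).re]
  by_contra! hneg
  set y := ∑ i, α i * c + ∑ j, β j * c + (∑ i, ∑ j, b i j * M i j).re
  set m : ℝ := c * (Fintype.card ι + Fintype.card κ)
  have hm : 0 ≤ m := by positivity
  -- With this δ the bound reads -y ≤ -y m / (m + 1), which is impossible for y < 0.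
  have h3 := h2 (-y / (m + 1)) (by apply div_pos <;> linarith)
  rw [div_mul_eq_mul_div, le_div_iff₀ (by linarith)] at h3
  nlinarith

/-- Otherwise a functional f separates the triple strictly from the convex cone. Its real part is
nonnegative on the cone, hence on diagonal and rank one elements, and
`IsSchurBounded.functional_nonneg` makes it nonnegative at the triple too. But separation from 0
makes it negative there. -/
theorem IsSchurBounded.mem_closure {c : ℝ} (hc : 0 ≤ c) {M : ι → κ → ℂ}
    (hM : IsSchurBounded c M) :
    ((fun _ => (c : ℂ), fun _ => (c : ℂ), M) : (ι → ℂ) × (κ → ℂ) × (ι → κ → ℂ)) ∈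
      closure (posSemidefCompletions ι κ) := by
  classical
  by_contra hmem
  obtain ⟨f, u, hfu, hf⟩ := RCLike.geometric_hahn_banach_point_closed (𝕜 := ℂ)
    convex_posSemidefCompletions.closure isClosed_closure hmem
  have hf' : ∀ x ∈ posSemidefCompletions ι κ, 0 ≤ (f x).re := by
    intro x hx
    by_contra! hneg
    have hu : u < 0 := by
      have := hf _ (subset_closure (smul_mem_posSemidefCompletions hx le_rfl))
      simpa using this
    -- The cone property allows rescaling x so that the real part of f equals u exactly.
    have h1 := hf _ (subset_closure (smul_mem_posSemidefCompletions hx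
      (div_nonneg_of_nonpos hu.le hneg.le)))
    rw [show f ((u / (f x).re) • x) = ((u / (f x).re : ℝ) : ℂ) • f x by
      rw [← map_smul]; rfl] at h1
    simp only [smul_eq_mul, RCLike.re_to_complex, Complex.re_ofReal_mul] at h1
    rw [div_mul_cancel₀ _ hneg.ne] at h1
    exact lt_irrefl _ h1
  have hdec : ∀ d e N, f (d, e, N) = ∑ i, d i * f (Pi.single i 1, 0, 0) +
      ∑ j, e j * f (0, Pi.single j 1, 0) +
      ∑ i, ∑ j, f (0, 0, Pi.single i (Pi.single j 1)) * N i j := by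
    intro d e N
    have h1 : (d, e, N) = ∑ i, d i • ((Pi.single i 1, 0, 0) : (ι → ℂ) × (κ → ℂ) × (ι → κ → ℂ)) +
        ∑ j, e j • ((0, Pi.single j 1, 0) : (ι → ℂ) × (κ → ℂ) × (ι → κ → ℂ)) +
        ∑ i, ∑ j, N i j •
          ((0, 0, Pi.single i (Pi.single j 1)) : (ι → ℂ) × (κ → ℂ) × (ι → κ → ℂ)) := by
      refine Prod.ext ?_ (Prod.ext ?_ ?_)
      · ext i
        simp [Prod.fst_sum, Finset.sum_apply, Pi.single_apply]
      · ext j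
        simp [Prod.fst_sum, Prod.snd_sum, Finset.sum_apply, Pi.single_apply]
      · ext i j
        simp only [Prod.snd_add, Prod.snd_sum, Prod.smul_snd, smul_zero, Finset.sum_const_zero,
          zero_add, Finset.sum_apply, Pi.smul_apply, smul_eq_mul]
        rw [Finset.sum_eq_single i, Finset.sum_eq_single j] <;>
          simp +contextual [Pi.single_apply, eq_comm]
    rw [h1]
    simp only [map_add, map_sum, map_smul, smul_eq_mul]
    simp only [mul_comm]
  have hα : ∀ i, 0 ≤ (f (Pi.single i 1, 0, 0)).re := fun i => by
    have := hf' _ (diagonal_mem_posSemidefCompletions (d := Pi.single i 1) (e := (0 : κ → ℝ))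
      (fun k => by by_cases h : k = i <;> simp [h]) fun _ => le_rfl)
    convert this using 5
    · rw [Pi.single_apply, Pi.single_apply]; split_ifs <;> simp
    · exact funext fun j => by simp
  have hβ : ∀ j, 0 ≤ (f (0, Pi.single j 1, 0)).re := fun j => by
    have := hf' _ (diagonal_mem_posSemidefCompletions (d := (0 : ι → ℝ)) (e := Pi.single j 1)
      (fun _ => le_rfl) fun k => by by_cases h : k = j <;> simp [h])
    convert this using 6
    · simp
    · rw [Pi.single_apply, Pi.single_apply]; split_ifs <;> simp
  have hmain := hM.functional_nonneg hc hα hβ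
    (b := fun i j => f (0, 0, Pi.single i (Pi.single j 1))) (fun z w => by
      have := hf' _ (mem_posSemidefCompletions z w)
      rw [hdec] at this
      simp only [Complex.add_re, Complex.re_sum, Complex.re_ofReal_mul] at this ⊢
      simpa only [mul_comm] using this)
  have h0 : 0 ∈ posSemidefCompletions ι κ :=
    ⟨0, Matrix.PosSemidef.zero, by simp, by simp, by simp⟩
  have hu := hf _ (subset_closure h0)
  rw [hdec] at hfu
  simp only [RCLike.re_to_complex, Complex.add_re, Complex.re_sum, Complex.re_ofReal_mul] at hfu
  simp only [Complex.re_sum, mul_comm _ c] at hmain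
  simp only [map_zero] at hu
  linarith

/-- A Schur multiplier is approximately the off-diagonal block of a Gram matrix with diagonal
bounded by the norm. -/
theorem IsSchurBounded.exists_vectors {c : ℝ} (hc : 0 ≤ c) {M : ι → κ → ℂ}
    (hM : IsSchurBounded c M) {ε : ℝ} (hε : 0 < ε) :
    ∃ x : ι ⊕ κ → EuclideanSpace ℂ (ι ⊕ κ), (∀ k, ‖x k‖ ^ 2 ≤ c + ε) ∧
      ∀ i j, ‖⟪x (.inl i), x (.inr j)⟫_ℂ - M i j‖ ≤ ε := by
  obtain ⟨⟨d, e, N⟩, ⟨X, hX, h1, h2, h3⟩, hd⟩ := Metric.mem_closure_iff.1 (hM.mem_closure hc) ε hε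
  obtain ⟨x, hx⟩ := exists_gram_vectors hX
  have hsq : ∀ k, ‖x k‖ ^ 2 = (X k k).re := fun k => by
    rw [← hx, inner_self_eq_norm_sq_to_K]
    norm_cast
  rw [Prod.dist_eq, Prod.dist_eq, max_lt_iff, max_lt_iff] at hd
  obtain ⟨hd1, hd2, hd3⟩ := hd
  refine ⟨x, ?_, fun i j => ?_⟩
  · rintro (i | j)
    · rw [hsq]
      have h4 := (dist_le_pi_dist _ _ i).trans hd1.le
      have h5 := (Complex.abs_re_le_norm _).trans ((dist_eq_norm _ _).symm.trans_le h4)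
      have h6 := h1 i
      simp only [Complex.sub_re, Complex.ofReal_re] at h5
      linarith [neg_abs_le (c - (d i).re)]
    · rw [hsq]
      have h4 := (dist_le_pi_dist _ _ j).trans hd2.le
      have h5 := (Complex.abs_re_le_norm _).trans ((dist_eq_norm _ _).symm.trans_le h4)
      have h6 := h2 j
      simp only [Complex.sub_re, Complex.ofReal_re] at h5
      linarith [neg_abs_le (c - (e j).re)]
  · rw [hx, h3, ← dist_eq_norm, dist_comm]
    exact (dist_le_pi_dist _ _ j).trans ((dist_le_pi_dist _ _ i).trans hd3.le)

end Gram

/-! ### Averages of Schur multipliers -/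

/-- The case of one by one matrices. -/
theorem norm_le_discreteSchurNorm {S : Type u} {T : Type v} {Φ : S × T → ℂ}
    (hΦ : IsDiscreteSchurMultiplier Φ) (x : S × T) : ‖Φ x‖ ≤ discreteSchurNorm Φ := by
  have h := isSchurBounded_of_injective hΦ (ι := Unit) (κ := Unit) (s := fun _ => x.1)
    (t := fun _ => x.2) (Function.injective_of_subsingleton _)
    (Function.injective_of_subsingleton _) (fun _ _ => 1) (fun z w hz hw => by
      simp only [Finset.univ_unique, Finset.sum_singleton, one_mul, norm_mul] at hz hw ⊢
      exact mul_le_one₀ ((sq_le_one_iff₀ (norm_nonneg _)).1 hz) (norm_nonneg _)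
        ((sq_le_one_iff₀ (norm_nonneg _)).1 hw)) (fun _ => 1) (fun _ => 1)
  simp only [Finset.univ_unique, Finset.sum_singleton, mul_one, norm_one, one_pow] at h
  linarith

section Average

variable {S : Type u} {T : Type v} [MeasurableSpace S] [MeasurableSpace T]
  {ι κ : Type*} [Fintype ι] [Fintype κ]

/-- On the product probability space the pair of coordinates (x_i, y_j) has law P_i × Q_j, so the
matrix of means is the mean of the random matrices Φ(x_i, y_j). Disjointness of the supporting sets
makes the points distinct almost surely, and the bound for each sample integrates. -/
theorem isSchurBounded_integral {Φ : S × T → ℂ} (hΦ : IsDiscreteSchurMultiplier Φ)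
    (P : ι → Measure S) (Q : κ → Measure T) [∀ i, IsProbabilityMeasure (P i)]
    [∀ j, IsProbabilityMeasure (Q j)] (hmeas : ∀ i j, AEMeasurable Φ ((P i).prod (Q j)))
    {A : ι → Set S} {B : κ → Set T} (hA : Pairwise (Function.onFun Disjoint A))
    (hB : Pairwise (Function.onFun Disjoint B)) (hPA : ∀ i, ∀ᵐ s ∂P i, s ∈ A i)
    (hQB : ∀ j, ∀ᵐ t ∂Q j, t ∈ B j) :
    IsSchurBounded (discreteSchurNorm Φ) fun i j => ∫ x, Φ x ∂(P i).prod (Q j) := by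
  intro a ha z w
  have hmp : ∀ i j, MeasurePreserving (fun x : (ι → S) × (κ → T) => (x.1 i, x.2 j))
      ((Measure.pi P).prod (Measure.pi Q)) ((P i).prod (Q j)) := fun i j =>
    (measurePreserving_eval P i).prod (measurePreserving_eval Q j)
  have hint : ∀ i j, ∫ x, Φ x ∂(P i).prod (Q j) =
      ∫ x, Φ (x.1 i, x.2 j) ∂(Measure.pi P).prod (Measure.pi Q) := fun i j => by
    rw [← (hmp i j).map_eq, integral_map (hmp i j).measurable.aemeasurable]
    rw [(hmp i j).map_eq]
    exact (hmeas i j).aestronglyMeasurable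
  have hint2 : ∀ i j, Integrable (fun x : (ι → S) × (κ → T) => Φ (x.1 i, x.2 j))
      ((Measure.pi P).prod (Measure.pi Q)) := fun i j =>
    Integrable.of_bound ((hmeas i j).comp_quasiMeasurePreserving
      (hmp i j).quasiMeasurePreserving).aestronglyMeasurable (discreteSchurNorm Φ)
      (Filter.Eventually.of_forall fun x => norm_le_discreteSchurNorm hΦ _)
  have h1 : ∑ i, ∑ j, (∫ x, Φ x ∂(P i).prod (Q j)) * a i j * z i * w j =
      ∫ x, ∑ i, ∑ j, Φ (x.1 i, x.2 j) * a i j * z i * w j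
        ∂(Measure.pi P).prod (Measure.pi Q) := by
    rw [integral_finsetSum _ fun i _ => integrable_finsetSum _ fun j _ =>
      (((hint2 i j).mul_const _).mul_const _).mul_const _]
    refine Finset.sum_congr rfl fun i _ => ?_
    rw [integral_finsetSum _ fun j _ => (((hint2 i j).mul_const _).mul_const _).mul_const _]
    refine Finset.sum_congr rfl fun j _ => ?_
    rw [integral_mul_const, integral_mul_const, integral_mul_const, hint]
  rw [h1]
  refine (norm_integral_le_of_norm_le_const (C := discreteSchurNorm Φ / 2 *
    (∑ i, ‖z i‖ ^ 2 + ∑ j, ‖w j‖ ^ 2)) ?_).trans (by simp)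
  have hs : ∀ᵐ x ∂(Measure.pi P).prod (Measure.pi Q), ∀ i, x.1 i ∈ A i :=
    ae_all_iff.2 fun i => ((measurePreserving_eval P i).comp
      measurePreserving_fst).quasiMeasurePreserving.ae (hPA i)
  have ht : ∀ᵐ x ∂(Measure.pi P).prod (Measure.pi Q), ∀ j, x.2 j ∈ B j :=
    ae_all_iff.2 fun j => ((measurePreserving_eval Q j).comp
      measurePreserving_snd).quasiMeasurePreserving.ae (hQB j)
  filter_upwards [hs, ht] with x hx hx'
  refine isSchurBounded_of_injective hΦ (s := x.1) (t := x.2) ?_ ?_ a ha z w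
  · intro i k hik
    by_contra h
    exact Set.disjoint_left.1 (hA h) (hx i) (hik ▸ hx k)
  · intro i k hik
    by_contra h
    exact Set.disjoint_left.1 (hB h) (hx' i) (hik ▸ hx' k)

/-- The previous bound for the normalized restrictions of μ and ν to the blocks. -/
theorem isSchurBounded_average {Φ : S × T → ℂ} (hΦ : IsDiscreteSchurMultiplier Φ)
    (μ : Measure S) (ν : Measure T) [IsFiniteMeasure μ] [IsFiniteMeasure ν]
    (hmeas : AEMeasurable Φ (μ.prod ν))
    {A : ι → Set S} {B : κ → Set T} (hA : Pairwise (Function.onFun Disjoint A))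
    (hB : Pairwise (Function.onFun Disjoint B)) (hAm : ∀ i, MeasurableSet (A i))
    (hBm : ∀ j, MeasurableSet (B j)) (hA0 : ∀ i, μ (A i) ≠ 0) (hB0 : ∀ j, ν (B j) ≠ 0) :
    IsSchurBounded (discreteSchurNorm Φ) fun i j =>
      ((μ.real (A i) * ν.real (B j) : ℝ) : ℂ)⁻¹ * ∫ x in A i ×ˢ B j, Φ x ∂μ.prod ν := by
  have hp : ∀ i, IsProbabilityMeasure (ProbabilityTheory.cond μ (A i)) := fun i =>
    ProbabilityTheory.cond_isProbabilityMeasure (hA0 i)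
  have hq : ∀ j, IsProbabilityMeasure (ProbabilityTheory.cond ν (B j)) := fun j =>
    ProbabilityTheory.cond_isProbabilityMeasure (hB0 j)
  have hprod : ∀ i j, (ProbabilityTheory.cond μ (A i)).prod (ProbabilityTheory.cond ν (B j)) =
      ((μ (A i))⁻¹ * (ν (B j))⁻¹) • (μ.prod ν).restrict (A i ×ˢ B j) := fun i j => by
    rw [ProbabilityTheory.cond, ProbabilityTheory.cond, Measure.prod_smul_left,
      Measure.prod_smul_right, Measure.prod_restrict, smul_smul]
  have h := isSchurBounded_integral hΦ (fun i => ProbabilityTheory.cond μ (A i))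
    (fun j => ProbabilityTheory.cond ν (B j)) (fun i j => by
      rw [hprod]
      exact (hmeas.mono_measure Measure.restrict_le_self).smul_measure _) hA hB
    (fun i => ProbabilityTheory.ae_cond_mem (hAm i))
    (fun j => ProbabilityTheory.ae_cond_mem (hBm j))
  convert h using 3 with i j
  rw [hprod, integral_smul_measure, ENNReal.toReal_mul, ENNReal.toReal_inv, ENNReal.toReal_inv,
    Complex.real_smul, ← mul_inv]
  push_cast
  rfl

end Average

/-- Every finite family of measurable sets is refined, up to a null set, by a finite family of
disjoint sets of positive measure. -/
theorem exists_finite_atoms {S : Type u} [MeasurableSpace S] (μ : Measure S)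
    (F : Finset (Set S)) (hF : ∀ E ∈ F, MeasurableSet E) :
    ∃ (n : ℕ) (A : Fin n → Set S), (∀ i, MeasurableSet (A i)) ∧
      Pairwise (Function.onFun Disjoint A) ∧ (∀ i, μ (A i) ≠ 0) ∧ μ (⋃ i, A i)ᶜ = 0 ∧
      ∀ E ∈ F, ∀ i, A i ⊆ E ∨ Disjoint (A i) E := by
  classical
  -- The atom of a membership pattern: points lying in exactly the prescribed members of F. Atoms of
  -- measure zero are discarded.
  let C : Set F → Set S := fun x => ⋂ E : F, if E ∈ x then (E : Set S) else (E : Set S)ᶜ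
  have hCm : ∀ x, MeasurableSet (C x) := fun x => MeasurableSet.iInter fun E => by
    split_ifs
    · exact hF _ E.2
    · exact (hF _ E.2).compl
  have hC : ∀ x s, s ∈ C x → ∀ E : F, E ∈ x ↔ s ∈ (E : Set S) := fun x s hs E => by
    have := Set.mem_iInter.1 hs E
    split_ifs at this with h
    · exact ⟨fun _ => this, fun _ => h⟩
    · exact ⟨fun h' => absurd h' h, fun h' => absurd h' this⟩
  have hCs : ∀ s, s ∈ C {E | s ∈ (E : Set S)} := fun s => Set.mem_iInter.2 fun E => by
    split_ifs with h <;> exact h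
  obtain ⟨n, ⟨e⟩⟩ := Finite.exists_equiv_fin {x : Set F // μ (C x) ≠ 0}
  refine ⟨n, fun i => C (e.symm i), fun i => hCm _, fun i j hij => ?_, fun i => (e.symm i).2,
    ?_, fun E hE i => ?_⟩
  · refine Set.disjoint_left.2 fun s hs hs' => hij (e.symm.injective (Subtype.ext (Set.ext ?_)))
    intro E
    rw [hC _ s hs, hC _ s hs']
  · refine measure_mono_null (t := ⋃ x : {x : Set F // μ (C x) = 0}, C x) (fun s hs => ?_)
      (measure_iUnion_null fun x => x.2)
    by_cases h : μ (C {E | s ∈ (E : Set S)}) = 0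
    · exact Set.mem_iUnion.2 ⟨⟨_, h⟩, hCs s⟩
    · refine absurd (Set.mem_iUnion.2 ⟨e ⟨_, h⟩, ?_⟩) hs
      rw [e.symm_apply_apply]
      exact hCs s
  · by_cases h : (⟨E, hE⟩ : F) ∈ (e.symm i : Set F)
    · exact Or.inl fun s hs => (hC _ s hs _).1 h
    · exact Or.inr (Set.disjoint_left.2 fun s hs hs' => h ((hC _ s hs ⟨E, hE⟩).2 hs'))

/-! ### Ultralimits of bounded operators -/

section Ultralimit

variable {E : Type*} [NormedAddCommGroup E] [InnerProductSpace ℂ E]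

/-- Bounded families of operators have weak operator limits along ultrafilters. -/
theorem exists_weak_ultralimit [CompleteSpace E] {J : Type*} (U : Ultrafilter J)
    (Q : J → E →L[ℂ] E) {C : ℝ}
    (hC : ∀ j, ‖Q j‖ ≤ C) :
    ∃ K : E →L[ℂ] E, ∀ f g, Filter.Tendsto (fun j => ⟪Q j f, g⟫_ℂ) U (nhds ⟪K f, g⟫_ℂ) := by
  have hb : ∀ f g j, ‖⟪Q j f, g⟫_ℂ‖ ≤ C * ‖f‖ * ‖g‖ := fun f g j =>
    (norm_inner_le_norm _ _).trans (mul_le_mul_of_nonneg_right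
      ((Q j).le_of_opNorm_le (hC j) f) (norm_nonneg g))
  have hlim : ∀ f g, ∃ x : ℂ, ‖x‖ ≤ C * ‖f‖ * ‖g‖ ∧
      Filter.Tendsto (fun j => ⟪Q j f, g⟫_ℂ) U (nhds x) := by
    intro f g
    -- Closed balls of ℂ are compact, so each bounded scalar family converges along U; the limits
    -- form a bounded sesquilinear form.
    obtain ⟨x, hx, hx'⟩ := (isCompact_closedBall (0 : ℂ) (C * ‖f‖ * ‖g‖)).ultrafilter_le_nhds
      (U.map fun j => ⟪Q j f, g⟫_ℂ) (by
        rw [Filter.le_principal_iff]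
        exact Filter.mem_map.2 (Filter.univ_mem' fun j => mem_closedBall_zero_iff.2 (hb f g j)))
    exact ⟨x, mem_closedBall_zero_iff.1 hx, hx'⟩
  choose b hbn hbt using hlim
  let L : E →ₗ⋆[ℂ] E →ₗ[ℂ] ℂ := LinearMap.mk₂'ₛₗ (starRingEnd ℂ) (RingHom.id ℂ) b
    (fun f f' g => tendsto_nhds_unique (hbt (f + f') g)
      (((hbt f g).add (hbt f' g)).congr fun j => by rw [map_add, inner_add_left]))
    (fun c f g => tendsto_nhds_unique (hbt (c • f) g)
      (((hbt f g).const_mul _).congr fun j => by rw [map_smul, inner_smul_left]))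
    (fun f g g' => tendsto_nhds_unique (hbt f (g + g'))
      (((hbt f g).add (hbt f g')).congr fun j => by rw [inner_add_right]))
    (fun c f g => tendsto_nhds_unique (hbt f (c • g))
      (((hbt f g).const_mul _).congr fun j => by rw [inner_smul_right]; rfl))
  refine ⟨InnerProductSpace.continuousLinearMapOfBilin (L.mkContinuous₂ C hbn), fun f g => ?_⟩
  rw [InnerProductSpace.continuousLinearMapOfBilin_apply]
  exact hbt f g

theorem isPositive_of_tendsto {J : Type*} {l : Filter J} [l.NeBot] {Q : J → E →L[ℂ] E}
    {K : E →L[ℂ] E} (hQ : ∀ j, (Q j).IsPositive)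
    (h : ∀ f, Filter.Tendsto (fun j => ⟪Q j f, f⟫_ℂ) l (nhds ⟪K f, f⟫_ℂ)) : K.IsPositive := by
  rw [ContinuousLinearMap.isPositive_iff_complex]
  intro f
  have hre := (Complex.continuous_re.tendsto _).comp (h f)
  refine ⟨?_, ge_of_tendsto' hre fun j => (hQ j).re_inner_nonneg_left f⟩
  refine tendsto_nhds_unique ((Complex.continuous_ofReal.tendsto _).comp hre)
    ((h f).congr fun j => ?_)
  exact (((ContinuousLinearMap.isPositive_iff_complex _).1 (hQ j)) f).1.symm

end Ultralimit

/-! ### Operators attached to finite families of sets -/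

section Blocks

variable {Z : Type*} [MeasurableSpace Z] {ρ : Measure Z} [IsFiniteMeasure ρ]

/-- The indicator function of a measurable set as an element of `L²`. -/
def indicatorL2 (ρ : Measure Z) [IsFiniteMeasure ρ] {E : Set Z} (hE : MeasurableSet E) :
    Lp ℂ 2 ρ :=
  indicatorConstLp 2 hE (measure_ne_top ρ E) 1

theorem inner_indicatorL2 {E : Set Z} (hE : MeasurableSet E) (f : Lp ℂ 2 ρ) :
    ⟪indicatorL2 ρ hE, f⟫_ℂ = ∫ z in E, f z ∂ρ :=
  L2.inner_indicatorConstLp_one hE (measure_ne_top ρ E) f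

theorem integral_norm_indicatorL2 {E : Set Z} (hE : MeasurableSet E) :
    ∫ z, ‖indicatorL2 ρ hE z‖ ∂ρ = ρ.real E := by
  have h : (fun z => ‖indicatorL2 ρ hE z‖) =ᵐ[ρ] E.indicator fun _ => (1 : ℝ) := by
    filter_upwards [indicatorConstLp_coeFn (p := 2) (hs := hE) (hμs := measure_ne_top ρ E)
      (c := (1 : ℂ))] with z hz
    rw [indicatorL2, hz]
    by_cases h : z ∈ E <;> simp [h]
  rw [integral_congr_ae h, integral_indicator_const _ hE]
  simp

theorem setIntegral_indicatorL2 {E G : Set Z} (hE : MeasurableSet E) (hG : MeasurableSet G) :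
    ∫ z in G, indicatorL2 ρ hE z ∂ρ = ρ.real (G ∩ E) := by
  have h := setIntegral_congr_ae (μ := ρ) hG ((indicatorConstLp_coeFn (p := 2) (hs := hE)
    (hμs := measure_ne_top ρ E) (c := (1 : ℂ))).mono fun z hz _ => hz)
  rw [indicatorL2, h, setIntegral_indicator hE]
  simp [Measure.real]

theorem integrable_of_L2 (f : Lp ℂ 2 ρ) : Integrable f ρ :=
  (Lp.memLp f).integrable (by norm_num)

theorem integral_norm_le_mul_norm (ρ : Measure Z) [IsFiniteMeasure ρ] :
    ∃ C : ℝ, 0 ≤ C ∧ ∀ f : Lp ℂ 2 ρ, ∫ z, ‖f z‖ ∂ρ ≤ C * ‖f‖ := by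
  refine ⟨(ρ Set.univ ^ (1 / (1 : ℝ≥0∞).toReal - 1 / (2 : ℝ≥0∞).toReal)).toReal,
    ENNReal.toReal_nonneg, fun f => ?_⟩
  have h := eLpNorm_le_eLpNorm_mul_rpow_measure_univ (μ := ρ) (p := 1) (q := 2) (by norm_num)
    (Lp.memLp f).1
  have hfin : ρ Set.univ ^ (1 / (1 : ℝ≥0∞).toReal - 1 / (2 : ℝ≥0∞).toReal) ≠ ∞ :=
    ENNReal.rpow_ne_top_of_nonneg (by norm_num) (measure_ne_top _ _)
  rw [integral_norm_eq_lintegral_enorm (Lp.memLp f).1, ← eLpNorm_one_eq_lintegral_enorm,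
    Lp.norm_def, mul_comm, ← ENNReal.toReal_mul]
  exact ENNReal.toReal_mono (ENNReal.mul_ne_top (Lp.memLp f).2.ne hfin) h

variable {ι : Type*} [Fintype ι] {H : Type*} [NormedAddCommGroup H] [InnerProductSpace ℂ H]

/-- The operator `f ↦ ∑ k, (∫_{C k} f) x k`. -/
def blockOperator (ρ : Measure Z) [IsFiniteMeasure ρ] {C : ι → Set Z}
    (hC : ∀ k, MeasurableSet (C k)) (x : ι → H) : Lp ℂ 2 ρ →L[ℂ] H :=
  ∑ k, (innerSL ℂ (indicatorL2 ρ (hC k))).smulRight (x k)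

theorem blockOperator_apply {C : ι → Set Z} (hC : ∀ k, MeasurableSet (C k)) (x : ι → H)
    (f : Lp ℂ 2 ρ) : blockOperator ρ hC x f = ∑ k, (∫ z in C k, f z ∂ρ) • x k := by
  simp only [blockOperator, sum_apply, ContinuousLinearMap.smulRight_apply,
    innerSL_apply_apply, inner_indicatorL2]

/-- The estimate is against the L¹ norm: on an indicator it gives r ρ(E), which is the source of the
bound c ρ(E)². -/
theorem norm_blockOperator_apply_le {C : ι → Set Z} (hC : ∀ k, MeasurableSet (C k))
    (hd : Pairwise (Function.onFun Disjoint C)) {x : ι → H} {r : ℝ} (hr : 0 ≤ r)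
    (hx : ∀ k, ‖x k‖ ≤ r) (f : Lp ℂ 2 ρ) :
    ‖blockOperator ρ hC x f‖ ≤ r * ∫ z, ‖f z‖ ∂ρ := by
  rw [blockOperator_apply]
  calc ‖∑ k, (∫ z in C k, f z ∂ρ) • x k‖ ≤ ∑ k, r * ∫ z in C k, ‖f z‖ ∂ρ := by
        refine norm_sum_le_of_le _ fun k _ => ?_
        rw [norm_smul, mul_comm]
        exact mul_le_mul (hx k) (norm_integral_le_integral_norm _) (norm_nonneg _) hr
    _ = r * ∫ z in ⋃ k, C k, ‖f z‖ ∂ρ := by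
        rw [← Finset.mul_sum, integral_iUnion_fintype hC hd
          fun k => (integrable_of_L2 f).norm.integrableOn]
    _ ≤ r * ∫ z, ‖f z‖ ∂ρ := mul_le_mul_of_nonneg_left
        (setIntegral_le_integral (integrable_of_L2 f).norm
          (Filter.Eventually.of_forall fun _ => norm_nonneg _)) hr

end Blocks

/-! ### The positive operator as a weak limit of step kernels -/

section Limit

variable {Z : Type*} [MeasurableSpace Z] {ρ : Measure Z} [IsFiniteMeasure ρ]

/-- The averages of `Ψ` over finite families of blocks in `Z₀ × Z₀ᶜ` are Schur multipliers of norm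
at most `c`. -/
def HasSchurAverages (c : ℝ) (ρ : Measure Z) (Z₀ : Set Z) (Ψ : Z × Z → ℂ) : Prop :=
  ∀ (m n : ℕ) (A : Fin m → Set Z) (B : Fin n → Set Z), Pairwise (Function.onFun Disjoint A) →
    Pairwise (Function.onFun Disjoint B) → (∀ i, MeasurableSet (A i)) →
    (∀ j, MeasurableSet (B j)) → (∀ i, ρ (A i) ≠ 0) → (∀ j, ρ (B j) ≠ 0) → (∀ i, A i ⊆ Z₀) →
    (∀ j, B j ⊆ Z₀ᶜ) → IsSchurBounded c fun i j =>
      ((ρ.real (A i) * ρ.real (B j) : ℝ) : ℂ)⁻¹ * ∫ x in A i ×ˢ B j, Ψ x ∂ρ.prod ρ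

theorem exists_finite_atoms_subset (ρ : Measure Z) {Z₀ : Set Z} (hZ₀ : MeasurableSet Z₀)
    (F : Finset (Set Z)) (hF : ∀ E ∈ F, MeasurableSet E) :
    ∃ (n : ℕ) (A : Fin n → Set Z), (∀ i, MeasurableSet (A i)) ∧
      Pairwise (Function.onFun Disjoint A) ∧ (∀ i, ρ (A i) ≠ 0) ∧ (∀ i, A i ⊆ Z₀) ∧
      ∀ E ∈ F, (∀ i, A i ∩ E = A i ∨ A i ∩ E = ∅) ∧
        (E ⊆ Z₀ → ⋃ i, A i ∩ E =ᵐ[ρ] E) := by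
  -- Restricting the measure discards the atoms that meet Z₀ in a null set, so the traces on Z₀ keep
  -- positive measure.
  obtain ⟨n, A, hAm, hAd, hA0, hAc, hAF⟩ := exists_finite_atoms (ρ.restrict Z₀) F hF
  refine ⟨n, fun i => A i ∩ Z₀, fun i => (hAm i).inter hZ₀, fun i j hij =>
    (hAd hij).mono Set.inter_subset_left Set.inter_subset_left, fun i => ?_,
    fun i => Set.inter_subset_right, fun E hE => ⟨fun i => ?_, fun hEZ => ?_⟩⟩
  · rw [← Measure.restrict_apply (hAm i)]
    exact hA0 i
  · rcases hAF E hE i with h | h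
    · exact Or.inl (Set.inter_eq_left.2 (Set.inter_subset_left.trans h))
    · exact Or.inr (Set.disjoint_iff_inter_eq_empty.1 (h.mono_left Set.inter_subset_left))
  · rw [← Set.iUnion_inter, ← Set.iUnion_inter, Set.inter_assoc, Set.inter_eq_right.2 hEZ,
      ae_eq_set]
    refine ⟨measure_mono_null (t := ∅) (fun z hz => hz.2 hz.1.2) measure_empty, ?_⟩
    rw [Measure.restrict_apply (MeasurableSet.iUnion hAm).compl] at hAc
    refine measure_mono_null (fun z hz => ?_) hAc
    exact ⟨fun h => hz.2 ⟨h, hz.1⟩, hEZ hz.1⟩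

theorem sum_measureReal_le {ι : Type*} [Fintype ι] {A : ι → Set Z} (hA : ∀ i, MeasurableSet (A i))
    (hd : Pairwise (Function.onFun Disjoint A)) : ∑ i, ρ.real (A i) ≤ ρ.real Set.univ := by
  rw [← measureReal_iUnion_fintype hd hA]
  exact measureReal_mono (Set.subset_univ _)

theorem setIntegral_prod_eq_sum {ρ : Measure Z} [SFinite ρ] {ι κ : Type*} [Fintype ι] [Fintype κ]
    {Ψ : Z × Z → ℂ} (hΨ : Integrable Ψ (ρ.prod ρ)) {A : ι → Set Z} {B : κ → Set Z} {E G : Set Z}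
    (hA : ∀ i, MeasurableSet (A i)) (hAd : Pairwise (Function.onFun Disjoint A))
    (hB : ∀ i, MeasurableSet (B i)) (hBd : Pairwise (Function.onFun Disjoint B))
    (hAE : ⋃ i, A i =ᵐ[ρ] E) (hBG : ⋃ j, B j =ᵐ[ρ] G) :
    ∫ x in E ×ˢ G, Ψ x ∂ρ.prod ρ = ∑ i, ∑ j, ∫ x in A i ×ˢ B j, Ψ x ∂ρ.prod ρ := by
  rw [← setIntegral_congr_set (Measure.set_prod_ae_eq hAE hBG),
    show (⋃ i, A i) ×ˢ (⋃ j, B j) = ⋃ k : ι × κ, A k.1 ×ˢ B k.2 by ext x; simp,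
    integral_iUnion_fintype (fun k : ι × κ => (hA k.1).prod (hB k.2)) _ fun k => hΨ.integrableOn,
    Fintype.sum_prod_type]
  intro k l hkl
  rw [Function.onFun, Set.disjoint_prod]
  by_cases h : k.1 = l.1
  · exact Or.inr (hBd fun h' => hkl (Prod.ext h h'))
  · exact Or.inl (hAd h)

/-- Since E and G are unions of blocks up to null sets, both quantities split over pairs of blocks.
On a pair inside E × G they differ by ρ(A_i) ρ(B_j) times the error of the inner product against the
average, and the measures of the blocks sum to at most the total mass. -/
theorem norm_inner_blockOperator_sub_le {Z₀ : Set Z} {Ψ : Z × Z → ℂ}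
    (hΨ : Integrable Ψ (ρ.prod ρ)) {ι κ H : Type*} [Fintype ι] [Fintype κ] [NormedAddCommGroup H]
    [InnerProductSpace ℂ H] {A : ι → Set Z} {B : κ → Set Z} (hAm : ∀ i, MeasurableSet (A i))
    (hAd : Pairwise (Function.onFun Disjoint A)) (hA0 : ∀ i, ρ (A i) ≠ 0) (hAZ : ∀ i, A i ⊆ Z₀)
    (hBm : ∀ i, MeasurableSet (B i)) (hBd : Pairwise (Function.onFun Disjoint B))
    (hB0 : ∀ i, ρ (B i) ≠ 0) (hBZ : ∀ i, B i ⊆ Z₀ᶜ) (hDm : ∀ k, MeasurableSet (Sum.elim A B k))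
    (x : ι ⊕ κ → H) {ε : ℝ} (hε : 0 < ε)
    (hxM : ∀ i j, ‖⟪x (.inl i), x (.inr j)⟫_ℂ - ((ρ.real (A i) * ρ.real (B j) : ℝ) : ℂ)⁻¹ *
      ∫ x in A i ×ˢ B j, Ψ x ∂ρ.prod ρ‖ ≤ ε) {E G : Set Z}
    (hE : MeasurableSet E) (hG : MeasurableSet G) (hEZ : E ⊆ Z₀) (hGZ : G ⊆ Z₀ᶜ)
    (hAE : ∀ i, A i ∩ E = A i ∨ A i ∩ E = ∅) (hAE' : ⋃ i, A i ∩ E =ᵐ[ρ] E)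
    (hBG : ∀ i, B i ∩ G = B i ∨ B i ∩ G = ∅) (hBG' : ⋃ i, B i ∩ G =ᵐ[ρ] G) :
    ‖⟪blockOperator ρ hDm x (indicatorL2 ρ hE), blockOperator ρ hDm x (indicatorL2 ρ hG)⟫_ℂ -
      ∫ x in E ×ˢ G, Ψ x ∂ρ.prod ρ‖ ≤ ε * ρ.real Set.univ ^ 2 := by
  have hz1 : ∀ j, B j ∩ E = ∅ := fun j => Set.disjoint_iff_inter_eq_empty.1
    (disjoint_compl_left.mono (hBZ j) hEZ)
  have hz2 : ∀ i, A i ∩ G = ∅ := fun i => Set.disjoint_iff_inter_eq_empty.1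
    (disjoint_compl_right.mono (hAZ i) hGZ)
  have hVE : blockOperator ρ hDm x (indicatorL2 ρ hE) =
      ∑ i, (ρ.real (A i ∩ E) : ℂ) • x (.inl i) := by
    rw [blockOperator_apply, Finset.sum_congr rfl fun k _ => by
      rw [setIntegral_indicatorL2 hE (hDm k)]]
    simp [Fintype.sum_sum_type, hz1]
  have hVG : blockOperator ρ hDm x (indicatorL2 ρ hG) =
      ∑ j, (ρ.real (B j ∩ G) : ℂ) • x (.inr j) := by
    rw [blockOperator_apply, Finset.sum_congr rfl fun k _ => by
      rw [setIntegral_indicatorL2 hG (hDm k)]]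
    simp [Fintype.sum_sum_type, hz2]
  have hint := setIntegral_prod_eq_sum hΨ (fun i => (hAm i).inter hE)
    (fun i j hij => (hAd hij).mono Set.inter_subset_left Set.inter_subset_left)
    (fun i => (hBm i).inter hG)
    (fun i j hij => (hBd hij).mono Set.inter_subset_left Set.inter_subset_left)
    hAE' hBG'
  have hsum : ⟪blockOperator ρ hDm x (indicatorL2 ρ hE), blockOperator ρ hDm x (indicatorL2 ρ hG)⟫_ℂ =
      ∑ i, ∑ j,
      (ρ.real (A i ∩ E) : ℂ) * (ρ.real (B j ∩ G) : ℂ) * ⟪x (.inl i), x (.inr j)⟫_ℂ := by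
    rw [hVE, hVG, sum_inner]
    refine Finset.sum_congr rfl fun i _ => ?_
    rw [inner_sum]
    refine Finset.sum_congr rfl fun j _ => ?_
    rw [inner_smul_left, inner_smul_right, Complex.conj_ofReal, mul_assoc]
  have hterm : ∀ i j, ‖(ρ.real (A i ∩ E) : ℂ) * (ρ.real (B j ∩ G) : ℂ) *
      ⟪x (.inl i), x (.inr j)⟫_ℂ - ∫ x in (A i ∩ E) ×ˢ (B j ∩ G), Ψ x ∂ρ.prod ρ‖ ≤
      ε * (ρ.real (A i) * ρ.real (B j)) := by
    intro i j
    have h0 : 0 ≤ ε * (ρ.real (A i) * ρ.real (B j)) := by positivity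
    rcases hAE i with hi | hi
    · rcases hBG j with hj | hj
      · rw [hi, hj]
        have hp : 0 < ρ.real (A i) * ρ.real (B j) :=
          mul_pos (ENNReal.toReal_pos (hA0 i) (measure_ne_top _ _))
            (ENNReal.toReal_pos (hB0 j) (measure_ne_top _ _))
        have h1 := hxM i j
        rw [← mul_le_mul_iff_right₀ hp] at h1
        refine le_trans (le_of_eq ?_) (h1.trans_eq (mul_comm _ _))
        have hp' : ((ρ.real (A i) * ρ.real (B j) : ℝ) : ℂ) ≠ 0 :=
          Complex.ofReal_ne_zero.2 hp.ne'
        rw [← Complex.norm_of_nonneg hp.le, ← norm_mul, mul_sub, Complex.norm_of_nonneg hp.le,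
          mul_inv_cancel_left₀ hp']
        push_cast
        rfl
      · rw [hj]
        simpa using h0
    · rw [hi]
      simpa using h0
  rw [hsum, hint, ← Finset.sum_sub_distrib]
  simp only [← Finset.sum_sub_distrib]
  calc _ ≤ ∑ i, ∑ j, ε * (ρ.real (A i) * ρ.real (B j)) :=
        norm_sum_le_of_le _ fun i _ => norm_sum_le_of_le _ fun j _ => hterm i j
    _ = ε * ((∑ i, ρ.real (A i)) * ∑ j, ρ.real (B j)) := by
        rw [Finset.sum_mul_sum]
        simp only [Finset.mul_sum]
    _ ≤ ε * ρ.real Set.univ ^ 2 := by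
        rw [sq]
        gcongr
        exacts [sum_measureReal_le hAm hAd, sum_measureReal_le hBm hBd]

theorem exists_isPositive_inner_eq {E H : Type*} [NormedAddCommGroup E] [InnerProductSpace ℂ E]
    [CompleteSpace E] [NormedAddCommGroup H] [InnerProductSpace ℂ H] [CompleteSpace H]
    (V : E →L[ℂ] H) : ∃ Q : E →L[ℂ] E, Q.IsPositive ∧ ‖Q‖ = ‖V‖ * ‖V‖ ∧
      ∀ f g, ⟪Q f, g⟫_ℂ = ⟪V f, V g⟫_ℂ :=
  ⟨ContinuousLinearMap.adjoint V ∘L V, ContinuousLinearMap.isPositive_adjoint_comp_self V,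
    ContinuousLinearMap.norm_adjoint_comp_self V,
    fun _ _ => by rw [ContinuousLinearMap.comp_apply, ContinuousLinearMap.adjoint_inner_left]⟩

/-- Q = V*V for the block operator V built from the Gram vectors of the averages over atoms of F in
Z₀ and in its complement. Requiring ε ≤ 1 keeps ‖Q‖ bounded independently of F and ε, as a weak
limit needs. -/
theorem HasSchurAverages.exists_approx {c : ℝ} (hc : 0 ≤ c) {Z₀ : Set Z} {Ψ : Z × Z → ℂ}
    (h : HasSchurAverages c ρ Z₀ Ψ) (hZ₀ : MeasurableSet Z₀) (hΨ : Integrable Ψ (ρ.prod ρ))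
    {C : ℝ} (hC : ∀ f : Lp ℂ 2 ρ, ∫ z, ‖f z‖ ∂ρ ≤ C * ‖f‖) (hC0 : 0 ≤ C)
    (F : Finset (Set Z)) (hF : ∀ E ∈ F, MeasurableSet E) {ε : ℝ} (hε : 0 < ε) (hε1 : ε ≤ 1) :
    ∃ Q : Lp ℂ 2 ρ →L[ℂ] Lp ℂ 2 ρ, Q.IsPositive ∧ ‖Q‖ ≤ (c + 1) * C ^ 2 ∧
      (∀ E (hE : MeasurableSet E), (⟪Q (indicatorL2 ρ hE), indicatorL2 ρ hE⟫_ℂ).re ≤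
        (c + ε) * ρ.real E ^ 2) ∧
      ∀ E ∈ F, ∀ G ∈ F, ∀ (hE : MeasurableSet E) (hG : MeasurableSet G), E ⊆ Z₀ → G ⊆ Z₀ᶜ →
        ‖⟪Q (indicatorL2 ρ hE), indicatorL2 ρ hG⟫_ℂ - ∫ x in E ×ˢ G, Ψ x ∂ρ.prod ρ‖ ≤
          ε * ρ.real Set.univ ^ 2 := by
  obtain ⟨m, A, hAm, hAd, hA0, hAZ, hAF⟩ := exists_finite_atoms_subset ρ hZ₀ F hF
  obtain ⟨n, B, hBm, hBd, hB0, hBZ, hBF⟩ := exists_finite_atoms_subset ρ hZ₀.compl F hF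
  obtain ⟨x, hx, hxM⟩ := (h m n A B hAd hBd hAm hBm hA0 hB0 hAZ hBZ).exists_vectors hc hε
  have hDm : ∀ k, MeasurableSet (Sum.elim A B k) := by
    rintro (i | j)
    exacts [hAm i, hBm j]
  have hDd : Pairwise (Function.onFun Disjoint (Sum.elim A B)) := by
    rintro (i | i) (j | j) hij
    · exact hAd fun h => hij (congrArg _ h)
    · exact (disjoint_compl_right.mono (hAZ i) (hBZ j))
    · exact (disjoint_compl_left.mono (hBZ i) (hAZ j))
    · exact hBd fun h => hij (congrArg _ h)
  set V := blockOperator ρ hDm x with hV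
  have hs0 : 0 ≤ c + ε := by linarith
  have hVn : ∀ f, ‖V f‖ ≤ √(c + ε) * ∫ z, ‖f z‖ ∂ρ := norm_blockOperator_apply_le hDm hDd
    (Real.sqrt_nonneg _) fun k => Real.le_sqrt_of_sq_le (hx k)
  obtain ⟨Q, hQp, hQn, hinner⟩ := exists_isPositive_inner_eq V
  refine ⟨Q, hQp, ?_, fun E hE => ?_, fun E hEF G hGF hE hG hEZ hGZ => ?_⟩
  · have h1 : ‖V‖ ≤ √(c + ε) * C := V.opNorm_le_bound (by positivity) fun f => by
      rw [mul_assoc]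
      exact (hVn f).trans (mul_le_mul_of_nonneg_left (hC f) (Real.sqrt_nonneg _))
    rw [hQn]
    calc ‖V‖ * ‖V‖ ≤ (√(c + ε) * C) * (√(c + ε) * C) :=
          mul_le_mul h1 h1 (norm_nonneg _) (by positivity)
      _ = (c + ε) * C ^ 2 := by
          rw [mul_mul_mul_comm, Real.mul_self_sqrt hs0, sq]
      _ ≤ (c + 1) * C ^ 2 := by gcongr
  · have h1 := hVn (indicatorL2 ρ hE)
    rw [integral_norm_indicatorL2] at h1
    rw [hinner, ← RCLike.re_to_complex, inner_self_eq_norm_sq]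
    calc ‖V (indicatorL2 ρ hE)‖ ^ 2 ≤ (√(c + ε) * ρ.real E) ^ 2 := by gcongr
      _ = _ := by rw [mul_pow, Real.sq_sqrt hs0]
  · rw [hinner]
    exact norm_inner_blockOperator_sub_le hΨ hAm hAd hA0 hAZ hBm hBd hB0 hBZ hDm x hε hxM hE hG
      hEZ hGZ (hAF E hEF).1 ((hAF E hEF).2 hEZ) (hBF G hGF).1 ((hBF G hGF).2 hGZ)

/-- The limit of the approximating operators. -/
theorem HasSchurAverages.exists_positive_operator {c : ℝ} (hc : 0 ≤ c) {Z₀ : Set Z}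
    {Ψ : Z × Z → ℂ} (h : HasSchurAverages c ρ Z₀ Ψ) (hZ₀ : MeasurableSet Z₀)
    (hΨ : Integrable Ψ (ρ.prod ρ)) :
    ∃ K : Lp ℂ 2 ρ →L[ℂ] Lp ℂ 2 ρ, K.IsPositive ∧
      (∀ E (hE : MeasurableSet E), (⟪K (indicatorL2 ρ hE), indicatorL2 ρ hE⟫_ℂ).re ≤
        c * ρ.real E ^ 2) ∧
      ∀ E G (hE : MeasurableSet E) (hG : MeasurableSet G), E ⊆ Z₀ → G ⊆ Z₀ᶜ →
        ⟪K (indicatorL2 ρ hE), indicatorL2 ρ hG⟫_ℂ = ∫ x in E ×ˢ G, Ψ x ∂ρ.prod ρ := by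
  classical
  obtain ⟨C, hC0, hC⟩ := integral_norm_le_mul_norm ρ
  -- The index directs both the family of sets to be resolved and the precision 1 / (n + 1).
  let J := Finset {E : Set Z // MeasurableSet E} × ℕ
  let ε : J → ℝ := fun j => 1 / ((j.2 : ℝ) + 1)
  have hεt : Filter.Tendsto ε Filter.atTop (nhds 0) := by
    have h1 : Filter.Tendsto (fun j : J => j.2) Filter.atTop Filter.atTop := by
      rw [← Filter.prod_atTop_atTop_eq]
      exact Filter.tendsto_snd
    exact tendsto_one_div_add_atTop_nhds_zero_nat.comp h1
  have happ := fun j : J => h.exists_approx hc hZ₀ hΨ hC hC0 (j.1.image Subtype.val)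
    (fun E hE => by
      obtain ⟨E', -, rfl⟩ := Finset.mem_image.1 hE
      exact E'.2) (ε := ε j) (by positivity)
    (div_le_one_of_le₀ (by linarith [Nat.cast_nonneg (α := ℝ) j.2]) (by positivity))
  choose Q hQp hQn hQE hQF using happ
  obtain ⟨U, hU⟩ := Ultrafilter.exists_le (Filter.atTop : Filter J)
  obtain ⟨K, hK⟩ := exists_weak_ultralimit U Q hQn
  refine ⟨K, isPositive_of_tendsto hQp fun f => hK f f, fun E hE => ?_,
    fun E G hE hG hEZ hGZ => ?_⟩
  · have h1 := (Complex.continuous_re.tendsto _).comp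
      (hK (indicatorL2 ρ hE) (indicatorL2 ρ hE))
    have h2 := ((hεt.mono_left hU).const_add c).mul_const (ρ.real E ^ 2)
    rw [add_zero] at h2
    exact le_of_tendsto_of_tendsto' h1 h2 fun j => hQE j E hE
  · have h1 := hK (indicatorL2 ρ hE) (indicatorL2 ρ hG)
    have h2 := (hεt.mono_left hU).mul_const (ρ.real Set.univ ^ 2)
    rw [zero_mul] at h2
    refine tendsto_nhds_unique h1 (tendsto_iff_norm_sub_tendsto_zero.2
      (squeeze_zero' (Filter.Eventually.of_forall fun _ => norm_nonneg _) ?_ h2))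
    -- Eventually both E and G belong to the resolved family.
    have h3 : ∀ᶠ j : J in Filter.atTop, ({⟨E, hE⟩, ⟨G, hG⟩}, 0) ≤ j :=
      Filter.eventually_ge_atTop _
    filter_upwards [hU h3] with j hj
    refine hQF j E ?_ G ?_ hE hG hEZ hGZ
    · exact Finset.mem_image.2 ⟨⟨E, hE⟩, hj.1 (by simp), rfl⟩
    · exact Finset.mem_image.2 ⟨⟨G, hG⟩, hj.1 (by simp), rfl⟩

end Limit

/-! ### Parseval sequences -/

section Parseval

variable {E : Type*} [NormedAddCommGroup E] [InnerProductSpace ℂ E]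

/-- Distinct orthonormal vectors are at distance √2, so balls of radius 1/2 about them are disjoint.
-/
theorem countable_of_orthonormal [TopologicalSpace.SeparableSpace E] {ι : Type*} {b : ι → E}
    (hb : Orthonormal ℂ b) : Countable ι := by
  refine Pairwise.countable_of_isOpen_disjoint (s := fun i => Metric.ball (b i) (1 / 2))
    (fun i j hij => Metric.ball_disjoint_ball ?_) (fun i => Metric.isOpen_ball)
    fun i => ⟨b i, Metric.mem_ball_self (by norm_num)⟩
  have h : ‖b i - b j‖ ^ 2 = 2 := by
    rw [@norm_sub_sq ℂ, hb.2 hij, hb.1 i, hb.1 j]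
    norm_num
  rw [dist_eq_norm]
  nlinarith [norm_nonneg (b i - b j)]

theorem exists_parseval_sequence [CompleteSpace E] [TopologicalSpace.SeparableSpace E] :
    ∃ u : ℕ → E, ∀ x y, HasSum (fun n => ⟪x, u n⟫_ℂ * ⟪u n, y⟫_ℂ) ⟪x, y⟫_ℂ := by
  obtain ⟨w, b, -⟩ := exists_hilbertBasis ℂ E
  have : Countable w := countable_of_orthonormal b.orthonormal
  obtain ⟨g, hg⟩ := exists_injective_nat w
  -- A countable, possibly finite, basis is padded with zeros to a sequence.
  refine ⟨Function.extend g b 0, fun x y => ?_⟩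
  rw [← hg.hasSum_iff]
  · have h : (fun n => ⟪x, Function.extend g b 0 n⟫_ℂ * ⟪Function.extend g b 0 n, y⟫_ℂ) ∘ g =
        fun i => ⟪x, b i⟫_ℂ * ⟪b i, y⟫_ℂ :=
      funext fun i => by rw [Function.comp_apply, hg.extend_apply]
    rw [h]
    exact b.hasSum_inner_mul_inner x y
  · intro n hn
    rw [Function.extend_apply' _ _ _ (by simpa using hn)]
    simp

/-- Parseval for ⟨Qf, Qg⟩ with Q the square root of K; the vectors are χ_n = Q u_n. -/
theorem exists_sequence_of_isPositive [CompleteSpace E] [TopologicalSpace.SeparableSpace E]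
    {K : E →L[ℂ] E} (hK : K.IsPositive) :
    ∃ χ : ℕ → E, ∀ f g, HasSum (fun n => ⟪f, χ n⟫_ℂ * ⟪χ n, g⟫_ℂ) ⟪K f, g⟫_ℂ := by
  obtain ⟨u, hu⟩ := exists_parseval_sequence (E := E)
  have hK0 : 0 ≤ K := (ContinuousLinearMap.nonneg_iff_isPositive K).2 hK
  set Q : E →L[ℂ] E := CFC.sqrt K with hQ
  have hQQ : Q * Q = K := CFC.sqrt_mul_sqrt_self _ hK0
  have hQsa : IsSelfAdjoint Q := (CFC.sqrt_nonneg K).isSelfAdjoint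
  have hsym : ∀ x y : E, ⟪x, Q y⟫_ℂ = ⟪Q x, y⟫_ℂ := fun x y => by
    rw [← ContinuousLinearMap.adjoint_inner_left, hQsa.adjoint_eq]
  refine ⟨fun n => Q (u n), fun f g => ?_⟩
  have h := hu (Q f) (Q g)
  rw [hsym, show Q (Q f) = K f by rw [← hQQ]; rfl] at h
  convert h using 2 with n
  rw [hsym f, hsym (u n) g]

end Parseval

/-! ### Pointwise bounds -/

section Pointwise

variable {Z : Type*} [MeasurableSpace Z] {ρ : Measure Z} [IsFiniteMeasure ρ]

/-- Duality replaces differentiation of measures: for fixed ζ, Cauchy–Schwarz and the hypothesis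
bound the integral of Re ⟨v, ζ⟩ over every E by √c ‖ζ‖ ρ(E), hence Re ⟨v, ζ⟩ ≤ √c ‖ζ‖ almost
everywhere. -/
theorem ae_sum_range_norm_sq_le {c : ℝ} (hc : 0 ≤ c) {χ : ℕ → Lp ℂ 2 ρ} (N : ℕ)
    (h : ∀ E, MeasurableSet E → ∑ k ∈ Finset.range N, ‖∫ z in E, χ k z ∂ρ‖ ^ 2 ≤
      c * ρ.real E ^ 2) :
    ∀ᵐ z ∂ρ, ∑ k ∈ Finset.range N, ‖χ k z‖ ^ 2 ≤ c := by
  let v : Z → EuclideanSpace ℂ (Fin N) := fun z => WithLp.toLp 2 fun k => star (χ k z)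
  have hv : ∀ z ζ, ⟪v z, ζ⟫_ℂ = ∑ k, ζ k * χ k z := fun z ζ => by
    rw [PiLp.inner_apply]
    exact Finset.sum_congr rfl fun k _ => by simp [v]
  have hint : ∀ ζ, Integrable (fun z => ⟪v z, ζ⟫_ℂ) ρ := fun ζ => by
    simp only [hv]
    exact integrable_finsetSum _ fun k _ => (integrable_of_L2 (χ k)).const_mul _
  have hζ : ∀ ζ : EuclideanSpace ℂ (Fin N),
      ∀ᵐ z ∂ρ, (⟪v z, ζ⟫_ℂ).re ≤ √c * ‖ζ‖ := fun ζ => by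
    refine ae_le_of_forall_setIntegral_le (hint ζ).re (integrable_const _) fun E hE _ => ?_
    let w : EuclideanSpace ℂ (Fin N) := WithLp.toLp 2 fun k => star (∫ z in E, χ k z ∂ρ)
    have hw : ∫ z in E, (⟪v z, ζ⟫_ℂ).re ∂ρ = (⟪w, ζ⟫_ℂ).re := by
      have h1 := integral_re (𝕜 := ℂ) (hint ζ).integrableOn (μ := ρ.restrict E)
      refine h1.trans ?_
      have h2 : ∫ z in E, ⟪v z, ζ⟫_ℂ ∂ρ = ∑ k : Fin N, ∫ z in E, ζ k * χ k z ∂ρ := by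
        simp only [hv]
        exact integral_finsetSum _ fun k _ =>
          ((integrable_of_L2 (χ k)).const_mul (ζ k)).integrableOn
      rw [h2, PiLp.inner_apply]
      refine congrArg Complex.re (Finset.sum_congr rfl fun k _ => ?_)
      rw [integral_const_mul]
      simp [w]
    have hwn : ‖w‖ ≤ √c * ρ.real E := by
      rw [EuclideanSpace.norm_eq]
      refine Real.sqrt_le_iff.2 ⟨by positivity, ?_⟩
      rw [mul_pow, Real.sq_sqrt hc]
      refine le_trans (le_of_eq ?_) (h E hE)
      rw [← Fin.sum_univ_eq_sum_range fun k => ‖∫ z in E, χ k z ∂ρ‖ ^ 2]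
      simp [w]
    refine hw.trans_le ?_
    rw [setIntegral_const, smul_eq_mul]
    calc (⟪w, ζ⟫_ℂ).re ≤ ‖w‖ * ‖ζ‖ := re_inner_le_norm (𝕜 := ℂ) w ζ
      _ ≤ (√c * ρ.real E) * ‖ζ‖ := by gcongr
      _ = _ := by ring
  have hall := ae_all_iff.2 fun n => hζ (TopologicalSpace.denseSeq _ n)
  -- One null set serves a dense sequence of ζ, hence all ζ by continuity, in particular ζ = v z.
  filter_upwards [hall] with z hz
  have h1 : ∀ ζ, (⟪v z, ζ⟫_ℂ).re ≤ √c * ‖ζ‖ := fun ζ =>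
    (TopologicalSpace.denseRange_denseSeq _).induction_on ζ
      (isClosed_le (by fun_prop) (by fun_prop)) hz
  have h2 := h1 (v z)
  rw [← RCLike.re_to_complex, inner_self_eq_norm_sq] at h2
  have h3 : ‖v z‖ ≤ √c := by
    by_contra! h4
    nlinarith [Real.sqrt_nonneg c]
  have h4 : ‖v z‖ ^ 2 ≤ c := by
    rw [← Real.sq_sqrt hc]
    gcongr
  rw [EuclideanSpace.norm_sq_eq] at h4
  rw [← Fin.sum_univ_eq_sum_range fun k => ‖χ k z‖ ^ 2]
  simpa [v] using h4

theorem tsum_enorm_sq_le {c : ℝ} {a : ℕ → ℂ}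
    (h : ∀ N, ∑ k ∈ Finset.range N, ‖a k‖ ^ 2 ≤ c) :
    ∑' n, ‖a n‖ₑ ^ 2 ≤ ENNReal.ofReal c := by
  refine ENNReal.tsum_le_of_sum_range_le fun N => ?_
  refine le_trans (le_of_eq ?_) (ENNReal.ofReal_le_ofReal (h N))
  rw [ENNReal.ofReal_sum_of_nonneg fun _ _ => by positivity]
  exact Finset.sum_congr rfl fun k _ => by
    rw [ENNReal.ofReal_pow (norm_nonneg _), ofReal_norm]

/-- Averages of `Ψ` that are Schur multipliers yield a factorization of `Ψ` on rectangles. -/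
theorem HasSchurAverages.exists_sequence [MeasurableSpace.CountablyGenerated Z] {c : ℝ}
    (hc : 0 ≤ c) {Z₀ : Set Z} {Ψ : Z × Z → ℂ} (h : HasSchurAverages c ρ Z₀ Ψ)
    (hZ₀ : MeasurableSet Z₀) (hΨ : Integrable Ψ (ρ.prod ρ)) :
    ∃ χ : ℕ → Z → ℂ, (∀ n, Measurable (χ n)) ∧ (∀ n, Integrable (χ n) ρ) ∧
      (∀ᵐ z ∂ρ, ∑' n, ‖χ n z‖ₑ ^ 2 ≤ ENNReal.ofReal c) ∧
      ∀ E G, MeasurableSet E → MeasurableSet G → E ⊆ Z₀ → G ⊆ Z₀ᶜ →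
        HasSum (fun n => (∫ z in E, χ n z ∂ρ) * star (∫ z in G, χ n z ∂ρ))
          (∫ x in E ×ˢ G, Ψ x ∂ρ.prod ρ) := by
  obtain ⟨K, hKp, hKE, hKΨ⟩ := h.exists_positive_operator hc hZ₀ hΨ
  -- These facts give access to the separability of L²(ρ), which rests on countable generation of
  -- the σ-algebra.
  have : Fact ((1 : ℝ≥0∞) ≤ 2) := ⟨by norm_num⟩
  have : Fact ((2 : ℝ≥0∞) ≠ ∞) := ⟨by norm_num⟩
  obtain ⟨χ, hχ⟩ := exists_sequence_of_isPositive hKp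
  refine ⟨fun n => χ n, fun n => (Lp.stronglyMeasurable (χ n)).measurable,
    fun n => integrable_of_L2 (χ n), ?_,
    fun E G hE hG hEZ hGZ => ?_⟩
  · have h1 : ∀ N, ∀ᵐ z ∂ρ, ∑ k ∈ Finset.range N, ‖χ k z‖ ^ 2 ≤ c := fun N => by
      refine ae_sum_range_norm_sq_le hc N fun E hE => (hKE E hE).trans' ?_
      have h2 := Complex.hasSum_re (hχ (indicatorL2 ρ hE) (indicatorL2 ρ hE))
      have h3 : ∀ n, (⟪indicatorL2 ρ hE, χ n⟫_ℂ * ⟪χ n, indicatorL2 ρ hE⟫_ℂ).re =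
          ‖∫ z in E, χ n z ∂ρ‖ ^ 2 := fun n => by
        rw [← inner_conj_symm (χ n), inner_indicatorL2, RCLike.mul_conj]
        norm_cast
      simp only [h3] at h2
      exact sum_le_hasSum _ (fun _ _ => by positivity) h2
    filter_upwards [ae_all_iff.2 h1] with z hz
    exact tsum_enorm_sq_le hz
  · have h1 := hχ (indicatorL2 ρ hE) (indicatorL2 ρ hG)
    rw [hKΨ E G hE hG hEZ hGZ] at h1
    convert h1 using 2 with n
    rw [← inner_conj_symm (χ n), inner_indicatorL2, inner_indicatorL2]
    rfl

end Pointwise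

/-! ### Sums of functions -/

section Sums

theorem ennreal_mul_le_half_add_sq (x y : ℝ≥0∞) : x * y ≤ (x ^ 2 + y ^ 2) / 2 := by
  rw [ENNReal.le_div_iff_mul_le (by simp) (by simp)]
  induction x with
  | top => simp
  | coe x =>
    induction y with
    | top => simp
    | coe y =>
      have h := two_mul_le_add_sq x y
      rw [mul_comm, ← mul_assoc]
      exact_mod_cast h

theorem tsum_mul_le_of_tsum_sq_le {ι : Type*} {x y : ι → ℝ≥0∞} {C : ℝ≥0∞}
    (hx : ∑' n, x n ^ 2 ≤ C) (hy : ∑' n, y n ^ 2 ≤ C) : ∑' n, x n * y n ≤ C := by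
  calc ∑' n, x n * y n ≤ ∑' n, (x n ^ 2 + y n ^ 2) / 2 :=
        ENNReal.tsum_le_tsum fun n => ennreal_mul_le_half_add_sq _ _
    _ = (∑' n, x n ^ 2 + ∑' n, y n ^ 2) / 2 := by
        simp only [div_eq_mul_inv]
        rw [ENNReal.tsum_mul_right, ENNReal.tsum_add]
    _ ≤ (C + C) / 2 := by gcongr
    _ = C := by rw [ENNReal.add_div, ENNReal.add_halves]

theorem tsum_enorm_mul_le {a b : ℕ → ℂ} {C : ℝ≥0∞} (ha : ∑' n, ‖a n‖ₑ ^ 2 ≤ C)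
    (hb : ∑' n, ‖b n‖ₑ ^ 2 ≤ C) : ∑' n, ‖a n * b n‖ₑ ≤ C := by
  simp only [enorm_mul]
  exact tsum_mul_le_of_tsum_sq_le ha hb

theorem summable_of_tsum_enorm_ne_top {a : ℕ → ℂ} (h : ∑' n, ‖a n‖ₑ ≠ ∞) : Summable a := by
  refine Summable.of_norm ?_
  simpa using ENNReal.summable_toReal h

variable {X : Type*} [MeasurableSpace X] {m : Measure X}

theorem hasSum_integral_of_tsum_enorm_le {F : ℕ → X → ℂ}
    (hF : ∀ n, AEStronglyMeasurable (F n) m) {g : X → ℝ} (hg : Integrable g m)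
    (hb : ∀ᵐ x ∂m, ∑' n, ‖F n x‖ₑ ≤ ‖g x‖ₑ) :
    (∀ᵐ x ∂m, Summable fun n => F n x) ∧ Integrable (fun x => ∑' n, F n x) m ∧
      HasSum (fun n => ∫ x, F n x ∂m) (∫ x, ∑' n, F n x ∂m) := by
  have hs : ∀ᵐ x ∂m, Summable fun n => F n x := by
    filter_upwards [hb] with x hx
    exact summable_of_tsum_enorm_ne_top (hx.trans_lt enorm_lt_top).ne
  have hsum : ∑' n, ∫⁻ x, ‖F n x‖ₑ ∂m ≠ ∞ := by
    rw [← lintegral_tsum fun n => (hF n).enorm]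
    exact ((lintegral_mono_ae hb).trans_lt hg.2).ne
  refine ⟨hs, ⟨?_, ?_⟩, ?_⟩
  · refine aestronglyMeasurable_of_tendsto_ae Filter.atTop
      (f := fun N x => ∑ n ∈ Finset.range N, F n x) (fun N => ?_) ?_
    · exact Finset.aestronglyMeasurable_fun_sum _ fun n _ => hF n
    · filter_upwards [hs] with x hx
      exact hx.hasSum.tendsto_sum_nat
  · refine (lintegral_mono_ae ?_).trans_lt hg.2
    filter_upwards [hb] with x hx
    exact enorm_tsum_le_tsum_enorm.trans hx
  · refine hasSum_integral_of_summable_integral_norm (fun n => ⟨hF n, ?_⟩) ?_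
    · exact (ENNReal.le_tsum n).trans_lt hsum.lt_top
    · have h := ENNReal.summable_toReal hsum
      refine h.congr fun n => ?_
      rw [integral_norm_eq_lintegral_enorm (hF n)]

end Sums

/-! ### Identification of kernels by their integrals over rectangles -/

section Rectangles

variable {X Y : Type*} [MeasurableSpace X] [MeasurableSpace Y] {μ : Measure X} {ν : Measure Y}
  [IsFiniteMeasure μ] [IsFiniteMeasure ν]

/-- Rectangles form a π-system generating the product σ-algebra, and the sets with equal integrals
are closed under complements and disjoint countable unions. -/
theorem ae_eq_of_setIntegral_prod_eq {f g : X × Y → ℂ} (hf : Integrable f (μ.prod ν))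
    (hg : Integrable g (μ.prod ν))
    (h : ∀ E G, MeasurableSet E → MeasurableSet G →
      ∫ x in E ×ˢ G, f x ∂μ.prod ν = ∫ x in E ×ˢ G, g x ∂μ.prod ν) : f =ᵐ[μ.prod ν] g := by
  have huniv : ∫ x, f x ∂μ.prod ν = ∫ x, g x ∂μ.prod ν := by
    simpa using h Set.univ Set.univ MeasurableSet.univ MeasurableSet.univ
  refine hf.ae_eq_of_forall_setIntegral_eq _ _ hg fun s hs _ => ?_
  induction s, hs using MeasurableSpace.induction_on_inter generateFrom_prod.symm
    isPiSystem_prod with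
  | empty => simp
  | basic t ht =>
    obtain ⟨E, hE, G, hG, rfl⟩ := ht
    exact h E G hE hG
  | compl t ht ih =>
    have h1 := integral_add_compl ht hf
    have h2 := integral_add_compl ht hg
    rw [ih (measure_lt_top _ _)] at h1
    rw [huniv, ← h2] at h1
    exact add_left_cancel h1
  | iUnion A hA hAm ih =>
    rw [integral_iUnion hAm hA hf.integrableOn, integral_iUnion hAm hA hg.integrableOn]
    exact tsum_congr fun i => ih i (measure_lt_top _ _)

theorem ae_tsum_enorm_mul_le {μ : Measure X} {ν : Measure Y} [SFinite μ] [SFinite ν]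
    {a : ℕ → X → ℂ} {b : ℕ → Y → ℂ} {C : ℝ≥0∞}
    (ha : ∀ᵐ x ∂μ, ∑' n, ‖a n x‖ₑ ^ 2 ≤ C) (hb : ∀ᵐ y ∂ν, ∑' n, ‖b n y‖ₑ ^ 2 ≤ C) :
    ∀ᵐ z ∂μ.prod ν, ∑' n, ‖a n z.1 * b n z.2‖ₑ ≤ C := by
  filter_upwards [Measure.quasiMeasurePreserving_fst.ae ha,
    Measure.quasiMeasurePreserving_snd.ae hb] with z h1 h2
  exact tsum_enorm_mul_le h1 h2

/-- The series is dominated by the constant c, so it may be integrated termwise over each rectangle;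
its sum then has the same rectangle integrals as Ψ. -/
theorem ae_hasSum_of_rectangles {a : ℕ → X → ℂ} {b : ℕ → Y → ℂ} (ham : ∀ n, Measurable (a n))
    (hbm : ∀ n, Measurable (b n)) {c : ℝ} (hc : 0 ≤ c)
    (ha : ∀ᵐ x ∂μ, ∑' n, ‖a n x‖ₑ ^ 2 ≤ ENNReal.ofReal c)
    (hb : ∀ᵐ y ∂ν, ∑' n, ‖b n y‖ₑ ^ 2 ≤ ENNReal.ofReal c) {Ψ : X × Y → ℂ}
    (hΨ : Integrable Ψ (μ.prod ν))
    (h : ∀ E G, MeasurableSet E → MeasurableSet G →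
      HasSum (fun n => (∫ x in E, a n x ∂μ) * ∫ y in G, b n y ∂ν)
        (∫ z in E ×ˢ G, Ψ z ∂μ.prod ν)) :
    ∀ᵐ z ∂μ.prod ν, HasSum (fun n => a n z.1 * b n z.2) (Ψ z) := by
  have hF : ∀ n, AEStronglyMeasurable (fun z : X × Y => a n z.1 * b n z.2) (μ.prod ν) := fun n =>
    (((ham n).comp measurable_fst).mul ((hbm n).comp measurable_snd)).aestronglyMeasurable
  have hbd : ∀ᵐ z ∂μ.prod ν, ∑' n, ‖a n z.1 * b n z.2‖ₑ ≤ ‖c‖ₑ := by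
    rw [Real.enorm_of_nonneg hc]
    exact ae_tsum_enorm_mul_le ha hb
  obtain ⟨hs, hi, -⟩ := hasSum_integral_of_tsum_enorm_le hF (integrable_const c) hbd
  have heq : Ψ =ᵐ[μ.prod ν] fun z => ∑' n, a n z.1 * b n z.2 := by
    refine ae_eq_of_setIntegral_prod_eq hΨ hi fun E G hE hG => ?_
    obtain ⟨-, -, h1⟩ := hasSum_integral_of_tsum_enorm_le
      (m := (μ.prod ν).restrict (E ×ˢ G)) (fun n => (hF n).restrict)
      (integrable_const c).integrableOn (ae_restrict_of_ae hbd)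
    refine (h E G hE hG).unique (h1.congr_fun ?_)
    intro n
    exact (setIntegral_prod_mul (a n) (b n) E G).symm
  filter_upwards [hs, heq] with z h1 h2
  rw [h2]
  exact h1.hasSum

end Rectangles

/-! ### Measurable functions on products factor through the Cantor space -/

section Cantor

variable {S : Type u} {T : Type v} [MeasurableSpace S] [MeasurableSpace T]

/-- The σ-algebra on `S × T` generated by `(s, t) ↦ (p s, q t)`. -/
abbrev codeSpace (p : S → ℕ → Bool) (q : T → ℕ → Bool) : MeasurableSpace (S × T) :=
  MeasurableSpace.comap (Prod.map p q) inferInstance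

/-- Countably many binary sequences are interleaved into one by the pairing function. -/
theorem exists_codeSpace_ge {p : ℕ → S → ℕ → Bool} {q : ℕ → T → ℕ → Bool}
    (hp : ∀ n, Measurable (p n)) (hq : ∀ n, Measurable (q n)) :
    ∃ (p' : S → ℕ → Bool) (q' : T → ℕ → Bool), Measurable p' ∧ Measurable q' ∧
      ∀ n, codeSpace (p n) (q n) ≤ codeSpace p' q' := by
  refine ⟨fun s k => p k.unpair.1 s k.unpair.2, fun t k => q k.unpair.1 t k.unpair.2,
    measurable_pi_lambda _ fun k => (measurable_pi_apply _).comp (hp _),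
    measurable_pi_lambda _ fun k => (measurable_pi_apply _).comp (hq _), fun n => ?_⟩
  let r : (ℕ → Bool) → ℕ → Bool := fun x k => x (Nat.pair n k)
  have hr : Measurable r := measurable_pi_lambda _ fun k => measurable_pi_apply _
  rintro _ ⟨E, hE, rfl⟩
  refine ⟨Prod.map r r ⁻¹' E, (hr.prodMap hr) hE, ?_⟩
  rw [← Set.preimage_comp]
  congr 1
  ext x <;> simp [r]

/-- Each set of the product σ-algebra is generated by countably many rectangles, whose sides can be
recorded as bits. -/
theorem exists_codeSpace_measurableSet {E : Set (S × T)} (hE : MeasurableSet E) :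
    ∃ (p : S → ℕ → Bool) (q : T → ℕ → Bool), Measurable p ∧ Measurable q ∧
      MeasurableSet[codeSpace p q] E := by
  classical
  rw [← generateFrom_prod] at hE
  induction E, hE using MeasurableSpace.generateFrom_induction with
  | hC E hE _ =>
    obtain ⟨A, hA, B, hB, rfl⟩ := hE
    refine ⟨fun s _ => decide (s ∈ A), fun t _ => decide (t ∈ B),
      measurable_pi_lambda _ fun _ => (measurable_to_bool (by simpa [Set.preimage] using hA)),
      measurable_pi_lambda _ fun _ => (measurable_to_bool (by simpa [Set.preimage] using hB)),
      ((fun x => x 0) ⁻¹' {true}) ×ˢ ((fun x => x 0) ⁻¹' {true}), ?_, ?_⟩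
    · exact (measurable_pi_apply 0 (measurableSet_singleton _)).prod
        (measurable_pi_apply 0 (measurableSet_singleton _))
    · ext x
      simp
  | empty => exact ⟨fun _ _ => true, fun _ _ => true, measurable_const, measurable_const,
      @MeasurableSet.empty _ (codeSpace _ _)⟩
  | compl E _ ih =>
    obtain ⟨p, q, hp, hq, h⟩ := ih
    exact ⟨p, q, hp, hq, @MeasurableSet.compl _ _ (codeSpace _ _) h⟩
  | iUnion E _ ih =>
    choose p q hp hq h using ih
    obtain ⟨p', q', hp', hq', hle⟩ := exists_codeSpace_ge hp hq
    exact ⟨p', q', hp', hq', @MeasurableSet.iUnion _ _ (codeSpace _ _) _ _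
      fun n => hle n _ (h n)⟩

/-- The Borel sets of ℂ are countably generated, so one pair of codes makes f measurable, and the
Doob–Dynkin lemma applies. -/
theorem exists_measurable_factorization {f : S × T → ℂ} (hf : Measurable f) :
    ∃ (p : S → ℕ → Bool) (q : T → ℕ → Bool) (g : (ℕ → Bool) × (ℕ → Bool) → ℂ), Measurable p ∧
      Measurable q ∧ Measurable g ∧ ∀ s t, f (s, t) = g (p s, q t) := by
  have h := fun n => exists_codeSpace_measurableSet
    (hf (MeasurableSpace.measurableSet_natGeneratingSequence (α := ℂ) n))
  choose p q hp hq h using h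
  obtain ⟨p', q', hp', hq', hle⟩ := exists_codeSpace_ge hp hq
  have hf' : Measurable[codeSpace p' q'] f := by
    have h1 := MeasurableSpace.generateFrom_natGeneratingSequence ℂ
    intro E hE
    rw [← h1] at hE
    refine (@measurable_generateFrom _ _ (codeSpace p' q') (Set.range
      (MeasurableSpace.natGeneratingSequence ℂ)) f ?_) hE
    rintro _ ⟨n, rfl⟩
    exact hle n _ (h n)
  obtain ⟨g, hg, hfg⟩ := hf'.exists_eq_measurable_comp
  exact ⟨p', q', g, hp', hq', hg, fun s t => congrFun hfg (s, t)⟩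

end Cantor

/-! ### Factorization of measurable Schur multipliers -/

section Factorization

variable {S : Type u} {T : Type v} [MeasurableSpace S] [MeasurableSpace T]

/-- The Boolean tag places the models of S and T in disjoint halves of one countably generated
space. -/
theorem exists_bounded_factorization {Φ : S × T → ℂ} {μ : Measure S} {ν : Measure T}
    (hΦ : AEMeasurable Φ (μ.prod ν)) {c : ℝ} (hc : 0 ≤ c) (hbound : ∀ x, ‖Φ x‖ ≤ c) :
    ∃ (p : S → Bool × (ℕ → Bool)) (q : T → Bool × (ℕ → Bool))
      (Ψ : (Bool × (ℕ → Bool)) × (Bool × (ℕ → Bool)) → ℂ), Measurable p ∧ Measurable q ∧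
      (∀ s, (p s).1 = false) ∧ (∀ t, (q t).1 = true) ∧
      Measurable Ψ ∧ (∀ x, ‖Ψ x‖ ≤ c) ∧ ∀ᵐ x ∂μ.prod ν, Φ x = Ψ (p x.1, q x.2) := by
  classical
  obtain ⟨p, q, g, hp, hq, hg, hfg⟩ := exists_measurable_factorization hΦ.measurable_mk
  -- Cutting off makes the bound hold everywhere; where Φ agrees with its measurable version nothing
  -- changes, as |Φ| ≤ c.
  let g' : (ℕ → Bool) × (ℕ → Bool) → ℂ := fun x => if ‖g x‖ ≤ c then g x else 0
  have hg' : Measurable g' := Measurable.ite (measurableSet_le hg.norm measurable_const) hg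
    measurable_const
  refine ⟨fun s => (false, p s), fun t => (true, q t), fun x => g' (x.1.2, x.2.2),
    measurable_const.prodMk hp, measurable_const.prodMk hq, fun _ => rfl, fun _ => rfl,
    hg'.comp (by fun_prop), fun x => ?_, ?_⟩
  · simp only [g']
    split_ifs with h
    · exact h
    · simpa using hc
  · filter_upwards [hΦ.ae_eq_mk] with x hx
    have h1 : Φ x = g (p x.1, q x.2) := by rw [hx, ← hfg]
    have h2 := hbound x
    simp only [g']
    rw [if_pos (h1 ▸ h2), h1]

/-- Factorization of a measurable discrete Schur multiplier, for finite measures. -/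
theorem exists_factorization_of_isFiniteMeasure (μ : Measure S) (ν : Measure T)
    [IsFiniteMeasure μ] [IsFiniteMeasure ν] {Φ : S × T → ℂ}
    (hΦ : IsDiscreteSchurMultiplier Φ) (hmeas : AEMeasurable Φ (μ.prod ν)) :
    ∃ (φ : ℕ → S → ℂ) (ψ : ℕ → T → ℂ), (∀ n, Measurable (φ n)) ∧ (∀ n, Measurable (ψ n)) ∧
      (∀ᵐ z ∂μ.prod ν, HasSum (fun n => φ n z.1 * ψ n z.2) (Φ z)) ∧
      (∀ᵐ s ∂μ, ∑' n, ‖φ n s‖ₑ ^ 2 ≤ ENNReal.ofReal (discreteSchurNorm Φ)) ∧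
      (∀ᵐ t ∂ν, ∑' n, ‖ψ n t‖ₑ ^ 2 ≤ ENNReal.ofReal (discreteSchurNorm Φ)) := by
  set c := discreteSchurNorm Φ with hc'
  have hc : 0 ≤ c := discreteSchurNorm_nonneg Φ
  obtain ⟨p, q, Ψ, hp, hq, hp0, hq0, hΨ, hΨc, hΦΨ⟩ :=
    exists_bounded_factorization hmeas hc (norm_le_discreteSchurNorm hΦ)
  set Z₀ : Set (Bool × (ℕ → Bool)) := Prod.fst ⁻¹' {false} with hZ
  have hZ₀ : MeasurableSet Z₀ := measurable_fst (measurableSet_singleton _)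
  -- The two image measures live on complementary halves, so restricting ρ recovers each of them.
  set ρ := μ.map p + ν.map q with hρ
  have hpZ : p ⁻¹' Z₀ = Set.univ := by ext s; simp [hZ, hp0]
  have hqZ : q ⁻¹' Z₀ᶜ = Set.univ := by ext t; simp [hZ, hq0]
  have hpZ' : p ⁻¹' Z₀ᶜ = ∅ := by rw [Set.preimage_compl, hpZ, Set.compl_univ]
  have hqZ' : q ⁻¹' Z₀ = ∅ := by
    rw [← compl_compl Z₀, Set.preimage_compl, hqZ, Set.compl_univ]
  have hρ0 : ρ.restrict Z₀ = μ.map p := by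
    rw [hρ, Measure.restrict_add, Measure.restrict_map hp hZ₀, Measure.restrict_map hq hZ₀, hpZ,
      hqZ', Measure.restrict_univ, Measure.restrict_empty, Measure.map_zero, add_zero]
  have hρ1 : ρ.restrict Z₀ᶜ = ν.map q := by
    rw [hρ, Measure.restrict_add, Measure.restrict_map hp hZ₀.compl,
      Measure.restrict_map hq hZ₀.compl, hpZ', hqZ, Measure.restrict_univ,
      Measure.restrict_empty, Measure.map_zero, zero_add]
  have hρE : ∀ E, MeasurableSet E → E ⊆ Z₀ → ρ E = μ (p ⁻¹' E) := fun E hE hEZ => by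
    rw [← Measure.map_apply hp hE, ← hρ0, Measure.restrict_apply hE, Set.inter_eq_left.2 hEZ]
  have hρG : ∀ G, MeasurableSet G → G ⊆ Z₀ᶜ → ρ G = ν (q ⁻¹' G) := fun G hG hGZ => by
    rw [← Measure.map_apply hq hG, ← hρ1, Measure.restrict_apply hG, Set.inter_eq_left.2 hGZ]
  have hΨi : ∀ {m : Measure ((Bool × (ℕ → Bool)) × (Bool × (ℕ → Bool)))} [IsFiniteMeasure m],
      Integrable Ψ m := fun {m} _ =>
    Integrable.of_bound hΨ.aestronglyMeasurable c (Filter.Eventually.of_forall hΨc)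
  have hint : ∀ E G, MeasurableSet E → MeasurableSet G → E ⊆ Z₀ → G ⊆ Z₀ᶜ →
      ∫ x in E ×ˢ G, Ψ x ∂ρ.prod ρ = ∫ x in (p ⁻¹' E) ×ˢ (q ⁻¹' G), Φ x ∂μ.prod ν := by
    intro E G hE hG hEZ hGZ
    have h1 : (ρ.prod ρ).restrict (E ×ˢ G) =
        ((μ.prod ν).map (Prod.map p q)).restrict (E ×ˢ G) := by
      rw [← Measure.map_prod_map _ _ hp hq, ← hρ0, ← hρ1, ← Measure.prod_restrict,
        ← Measure.prod_restrict, Measure.restrict_restrict hE, Measure.restrict_restrict hG,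
        Set.inter_eq_left.2 hEZ, Set.inter_eq_left.2 hGZ]
    rw [h1, setIntegral_map (hE.prod hG) hΨ.aestronglyMeasurable (hp.prodMap hq).aemeasurable]
    refine setIntegral_congr_ae ((hp hE).prod (hq hG)) ?_
    filter_upwards [hΦΨ] with x hx _
    exact hx.symm
  have hav : HasSchurAverages c ρ Z₀ Ψ := by
    intro m n A B hAd hBd hAm hBm hA0 hB0 hAZ hBZ
    have h1 := isSchurBounded_average hΦ μ ν hmeas (A := fun i => p ⁻¹' A i)
      (B := fun j => q ⁻¹' B j) (fun i j hij => (hAd hij).preimage p)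
      (fun i j hij => (hBd hij).preimage q) (fun i => hp (hAm i)) (fun j => hq (hBm j))
      (fun i => by rw [← hρE _ (hAm i) (hAZ i)]; exact hA0 i)
      (fun j => by rw [← hρG _ (hBm j) (hBZ j)]; exact hB0 j)
    convert h1 using 3 with i j
    rw [Measure.real, Measure.real, Measure.real, Measure.real, hρE _ (hAm i) (hAZ i),
      hρG _ (hBm j) (hBZ j), hint _ _ (hAm i) (hBm j) (hAZ i) (hBZ j)]
  obtain ⟨χ, hχm, hχi, hχb, hχs⟩ := hav.exists_sequence hc hZ₀ hΨi
  have hb0 : ∀ᵐ z ∂μ.map p, ∑' n, ‖χ n z‖ₑ ^ 2 ≤ ENNReal.ofReal c :=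
    hρ0 ▸ ae_restrict_of_ae hχb
  have hb1 : ∀ᵐ z ∂ν.map q, ∑' n, ‖star (χ n z)‖ₑ ^ 2 ≤ ENNReal.ofReal c := by
    have h1 : ∀ᵐ z ∂ν.map q, ∑' n, ‖χ n z‖ₑ ^ 2 ≤ ENNReal.ofReal c := hρ1 ▸ ae_restrict_of_ae hχb
    filter_upwards [h1] with z hz
    simpa only [Complex.star_def, RCLike.enorm_conj] using hz
  have hstar : ∀ n, Measurable fun z => star (χ n z) := fun n =>
    continuous_star.measurable.comp (hχm n)
  have hsum : ∀ᵐ z ∂(μ.map p).prod (ν.map q), HasSum (fun n => χ n z.1 * star (χ n z.2)) (Ψ z) := by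
    refine ae_hasSum_of_rectangles hχm hstar hc hb0 hb1 hΨi fun E G hE hG => ?_
    have h1 := hχs (E ∩ Z₀) (G ∩ Z₀ᶜ) (hE.inter hZ₀) (hG.inter hZ₀.compl) Set.inter_subset_right
      Set.inter_subset_right
    convert h1 using 2 with n
    · rw [← hρ0, ← hρ1, Measure.restrict_restrict hE, Measure.restrict_restrict hG]
      congr 1
      exact integral_conj
    · rw [← hρ0, ← hρ1, Measure.prod_restrict, Measure.restrict_restrict (hE.prod hG),
        Set.prod_inter_prod]
  refine ⟨fun n s => χ n (p s), fun n t => star (χ n (q t)), fun n => (hχm n).comp hp,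
    fun n => (hstar n).comp hq, ?_, ae_of_ae_map hp.aemeasurable hb0,
    ae_of_ae_map hq.aemeasurable hb1⟩
  rw [Measure.map_prod_map _ _ hp hq] at hsum
  filter_upwards [hΦΨ, ae_of_ae_map (hp.prodMap hq).aemeasurable hsum] with x h1 h2
  rw [h1]
  exact h2

/-- Factorization of a measurable discrete Schur multiplier, for `σ`-finite measures. -/
theorem exists_factorization (μ : Measure S) (ν : Measure T) [SFinite μ] [SFinite ν]
    {Φ : S × T → ℂ} (hΦ : IsDiscreteSchurMultiplier Φ) (hmeas : AEMeasurable Φ (μ.prod ν)) :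
    ∃ (φ : ℕ → S → ℂ) (ψ : ℕ → T → ℂ), (∀ n, Measurable (φ n)) ∧ (∀ n, Measurable (ψ n)) ∧
      (∀ᵐ z ∂μ.prod ν, HasSum (fun n => φ n z.1 * ψ n z.2) (Φ z)) ∧
      (∀ᵐ s ∂μ, ∑' n, ‖φ n s‖ₑ ^ 2 ≤ ENNReal.ofReal (discreteSchurNorm Φ)) ∧
      (∀ᵐ t ∂ν, ∑' n, ‖ψ n t‖ₑ ^ 2 ≤ ENNReal.ofReal (discreteSchurNorm Φ)) := by
  -- The conclusion depends on the measures only through their null sets, so equivalent finite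
  -- measures suffice.
  obtain ⟨μ', hμ', hμμ', hμ'μ⟩ := exists_isFiniteMeasure_absolutelyContinuous μ
  obtain ⟨ν', hν', hνν', hν'ν⟩ := exists_isFiniteMeasure_absolutelyContinuous ν
  obtain ⟨φ, ψ, hφ, hψ, hs, h1, h2⟩ := exists_factorization_of_isFiniteMeasure μ' ν' hΦ
    (hmeas.mono_ac (hμ'μ.prod hν'ν))
  exact ⟨φ, ψ, hφ, hψ, (hμμ'.prod hνν').ae_le hs, hμμ'.ae_le h1, hνν'.ae_le h2⟩

theorem memLp_top_of_tsum_enorm_sq_le {X : Type*} [MeasurableSpace X] {m : Measure X}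
    {φ : ℕ → X → ℂ} (hφ : ∀ n, Measurable (φ n)) {c : ℝ}
    (h : ∀ᵐ x ∂m, ∑' n, ‖φ n x‖ₑ ^ 2 ≤ ENNReal.ofReal c) (n : ℕ) : MemLp (φ n) ∞ m := by
  refine memLp_top_of_bound (hφ n).aestronglyMeasurable (√c) ?_
  filter_upwards [h] with x hx
  have h1 := (ENNReal.le_tsum n).trans hx
  rw [← ofReal_norm, ← ENNReal.ofReal_pow (norm_nonneg _)] at h1
  rcases le_or_gt 0 c with hc | hc
  · exact Real.le_sqrt_of_sq_le ((ENNReal.ofReal_le_ofReal_iff hc).1 h1)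
  · rw [ENNReal.ofReal_of_nonpos hc.le, nonpos_iff_eq_zero, ENNReal.ofReal_eq_zero] at h1
    have h2 : ‖φ n x‖ = 0 := by nlinarith [norm_nonneg (φ n x)]
    rw [h2]
    positivity

end Factorization

/-! ### The trace norm -/

section Trace

variable {E F : Type*}
  [NormedAddCommGroup E] [InnerProductSpace ℂ E] [CompleteSpace E]
  [NormedAddCommGroup F] [InnerProductSpace ℂ F] [CompleteSpace F]

/-- Douglas' factorization lemma. -/
theorem exists_contraction_comp_eq {E F G : Type*} [NormedAddCommGroup E] [InnerProductSpace ℂ E]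
    [NormedAddCommGroup F] [InnerProductSpace ℂ F] [CompleteSpace F]
    [NormedAddCommGroup G] [InnerProductSpace ℂ G] [CompleteSpace G]
    (A : E →L[ℂ] F) (B : E →L[ℂ] G) (h : ∀ x, ‖A x‖ ≤ ‖B x‖) :
    ∃ U : G →L[ℂ] F, ‖U‖ ≤ 1 ∧ ∀ x, U (B x) = A x := by
  -- B x ↦ A x is a well-defined contraction on the range of B. It extends to the closure R and is
  -- composed with the projection onto R.
  let R : Submodule ℂ G := (LinearMap.range (B : E →ₗ[ℂ] G)).topologicalClosure
  have hR : ∀ x, B x ∈ R := fun x => Submodule.le_topologicalClosure _ ⟨x, rfl⟩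
  let e : E →ₗ[ℂ] R := (B : E →ₗ[ℂ] G).codRestrict R hR
  have he : DenseRange e := by
    intro y
    rw [closure_subtype]
    have h1 : Subtype.val '' Set.range e = LinearMap.range (B : E →ₗ[ℂ] G) := by
      ext z
      simp [e]
    rw [h1]
    exact y.2
  have hn : ∀ x, ‖(A : E →ₗ[ℂ] F) x‖ ≤ 1 * ‖e x‖ := fun x => by
    rw [one_mul]
    exact h x
  have : CompleteSpace R := (Submodule.isClosed_topologicalClosure _).completeSpace_coe
  refine ⟨((A : E →ₗ[ℂ] F).extendOfNorm e) ∘L R.orthogonalProjectionOnto, ?_, fun x => ?_⟩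
  · refine ContinuousLinearMap.opNorm_le_bound _ zero_le_one fun y => ?_
    refine (LinearMap.norm_extendOfNorm_apply_le he 1 hn _).trans ?_
    exact mul_le_mul_of_nonneg_left (R.norm_orthogonalProjectionOnto_apply_le y) zero_le_one
  · rw [ContinuousLinearMap.comp_apply]
    have h1 : R.orthogonalProjectionOnto (B x) = e x :=
      Submodule.orthogonalProjectionOnto_mem_subspace_eq_self (e x)
    rw [h1]
    exact LinearMap.extendOfNorm_eq he ⟨1, hn⟩ x

theorem isPositive_opAbs (A : E →L[ℂ] F) : (opAbs A).IsPositive :=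
  (ContinuousLinearMap.nonneg_iff_isPositive _).1 (CFC.sqrt_nonneg _)

theorem norm_opAbs_apply (A : E →L[ℂ] F) (x : E) : ‖opAbs A x‖ = ‖A x‖ := by
  have hp : 0 ≤ (ContinuousLinearMap.adjoint A) ∘L A :=
    (ContinuousLinearMap.nonneg_iff_isPositive _).2
      (ContinuousLinearMap.isPositive_adjoint_comp_self A)
  have hsq : opAbs A * opAbs A = (ContinuousLinearMap.adjoint A) ∘L A :=
    CFC.sqrt_mul_sqrt_self _ hp
  have h1 : ⟪opAbs A x, opAbs A x⟫_ℂ = ⟪A x, A x⟫_ℂ := by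
    rw [(isPositive_opAbs A).inner_left_eq_inner_right,
      show opAbs A (opAbs A x) = (opAbs A * opAbs A) x from rfl, hsq,
      ContinuousLinearMap.comp_apply, ContinuousLinearMap.adjoint_inner_right]
  rw [inner_self_eq_norm_sq_to_K, inner_self_eq_norm_sq_to_K] at h1
  have h2 : ‖opAbs A x‖ ^ 2 = ‖A x‖ ^ 2 := by exact_mod_cast h1
  exact (sq_eq_sq₀ (norm_nonneg _) (norm_nonneg _)).1 h2

/-- The operator `Q = |A|^{1/2}` is Hilbert–Schmidt when `A` is of trace class. -/
theorem exists_opAbs_sqrt (A : E →L[ℂ] F) :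
    ∃ Q : E →L[ℂ] E, (∀ x y, ⟪x, Q y⟫_ℂ = ⟪Q x, y⟫_ℂ) ∧ (∀ x, Q (Q x) = opAbs A x) ∧
      ∀ {ι : Type _} (e : HilbertBasis ι ℂ E), traceNorm A = ∑' i, ‖Q (e i)‖ₑ ^ 2 := by
  have hQQ : CFC.sqrt (opAbs A) * CFC.sqrt (opAbs A) = opAbs A :=
    CFC.sqrt_mul_sqrt_self _ (CFC.sqrt_nonneg _)
  have hsa : IsSelfAdjoint (CFC.sqrt (opAbs A)) := (CFC.sqrt_nonneg (opAbs A)).isSelfAdjoint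
  have hsym : ∀ x y : E, ⟪x, CFC.sqrt (opAbs A) y⟫_ℂ = ⟪CFC.sqrt (opAbs A) x, y⟫_ℂ := fun x y => by
    rw [← ContinuousLinearMap.adjoint_inner_left, hsa.adjoint_eq]
  have hQ : ∀ x, CFC.sqrt (opAbs A) (CFC.sqrt (opAbs A) x) = opAbs A x := fun x => by
    nth_rw 3 [← hQQ]
    rfl
  refine ⟨CFC.sqrt (opAbs A), hsym, hQ, fun {ι} e => ?_⟩
  rw [traceNorm_eq e]
  refine tsum_congr fun i => ?_
  rw [← hQ, hsym, inner_self_eq_norm_sq, ENNReal.ofReal_pow (norm_nonneg _), ofReal_norm]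

/-- Invariance of the Hilbert–Schmidt norm under adjoints. Only the adjoint relation is used, so
plain maps suffice and multiplications by functions need not be packaged as operators. -/
theorem tsum_tsum_enorm_sq_comm {ι : Type*} (e : HilbertBasis ι ℂ E) {R R' : ℕ → E → E}
    (h : ∀ n x y, ⟪x, R n y⟫_ℂ = ⟪R' n x, y⟫_ℂ) :
    ∑' i, ∑' n, ‖R n (e i)‖ₑ ^ 2 = ∑' i, ∑' n, ‖R' n (e i)‖ₑ ^ 2 := by
  rw [ENNReal.tsum_comm, ENNReal.tsum_comm (f := fun i n => ‖R' n (e i)‖ₑ ^ 2)]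
  refine tsum_congr fun n => ?_
  calc ∑' i, ‖R n (e i)‖ₑ ^ 2 = ∑' i, ∑' j, ‖⟪e j, R n (e i)⟫_ℂ‖ₑ ^ 2 := by
        simp only [parseval_enorm e]
    _ = ∑' j, ∑' i, ‖⟪e j, R n (e i)⟫_ℂ‖ₑ ^ 2 := ENNReal.tsum_comm
    _ = ∑' j, ∑' i, ‖⟪e i, R' n (e j)⟫_ℂ‖ₑ ^ 2 := by
        refine tsum_congr fun j => tsum_congr fun i => ?_
        rw [h, ← inner_conj_symm, RCLike.enorm_conj]
    _ = ∑' j, ‖R' n (e j)‖ₑ ^ 2 := by simp only [parseval_enorm e]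

theorem enorm_apply_le_of_norm_le_one {E F : Type*} [NormedAddCommGroup E] [InnerProductSpace ℂ E]
    [NormedAddCommGroup F] [InnerProductSpace ℂ F] {U : E →L[ℂ] F} (hU : ‖U‖ ≤ 1) (x : E) :
    ‖U x‖ₑ ≤ ‖x‖ₑ := by
  rw [enorm_le_iff_norm_le]
  simpa using U.le_of_opNorm_le hU x

/-- The trace norm of `∑ n, Y n* A X n`. -/
theorem traceNorm_le_of_hasSum {A A' : E →L[ℂ] F} {X X' : ℕ → E → E} {Y Y' : ℕ → F → F} {C : ℝ≥0∞}
    (hX : ∀ n x y, ⟪x, X n y⟫_ℂ = ⟪X' n x, y⟫_ℂ) (hY : ∀ n x y, ⟪x, Y n y⟫_ℂ = ⟪Y' n x, y⟫_ℂ)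
    (hX' : ∀ x, ∑' n, ‖X' n x‖ₑ ^ 2 ≤ C * ‖x‖ₑ ^ 2)
    (hY' : ∀ y, ∑' n, ‖Y' n y‖ₑ ^ 2 ≤ C * ‖y‖ₑ ^ 2)
    (h : ∀ x y, HasSum (fun n => ⟪Y n y, A (X n x)⟫_ℂ) ⟪y, A' x⟫_ℂ) :
    traceNorm A' ≤ C * traceNorm A := by
  obtain ⟨w, e, -⟩ := exists_hilbertBasis ℂ E
  obtain ⟨Q, hQs, hQQ, hQt⟩ := exists_opAbs_sqrt A
  -- Polar decompositions in the form U |A| = A and W A' = |A'|, with contractions U and W.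
  obtain ⟨U, hU, hUA⟩ := exists_contraction_comp_eq A (opAbs A) fun x => (norm_opAbs_apply A x).ge
  obtain ⟨W, hW, hWA⟩ := exists_contraction_comp_eq (opAbs A') A'
    fun x => (norm_opAbs_apply A' x).le
  have h1 : ∑' i, ∑' n, ‖Q (X n (e i))‖ₑ ^ 2 ≤ C * traceNorm A := by
    rw [tsum_tsum_enorm_sq_comm e (R := fun n x => Q (X n x)) (R' := fun n x => X' n (Q x))
      fun n x y => by rw [hQs, hX], hQt e, ← ENNReal.tsum_mul_left]
    exact ENNReal.tsum_le_tsum fun i => hX' _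
  have h2 : ∑' i, ∑' n, ‖Q (ContinuousLinearMap.adjoint U
      (Y n (ContinuousLinearMap.adjoint W (e i))))‖ₑ ^ 2 ≤ C * traceNorm A := by
    rw [tsum_tsum_enorm_sq_comm e
      (R := fun n x => Q (ContinuousLinearMap.adjoint U (Y n (ContinuousLinearMap.adjoint W x))))
      (R' := fun n x => W (Y' n (U (Q x)))) fun n x y => by
        rw [hQs, ContinuousLinearMap.adjoint_inner_right, hY,
          ContinuousLinearMap.adjoint_inner_right], hQt e, ← ENNReal.tsum_mul_left]
    refine ENNReal.tsum_le_tsum fun i => ?_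
    calc ∑' n, ‖W (Y' n (U (Q (e i))))‖ₑ ^ 2 ≤ ∑' n, ‖Y' n (U (Q (e i)))‖ₑ ^ 2 :=
          ENNReal.tsum_le_tsum fun n => by
            gcongr
            exact enorm_apply_le_of_norm_le_one hW _
      _ ≤ C * ‖U (Q (e i))‖ₑ ^ 2 := hY' _
      _ ≤ C * ‖Q (e i)‖ₑ ^ 2 := by
          gcongr
          exact enorm_apply_le_of_norm_le_one hU _
  -- Writing A = U Q Q, the term ⟨e_i, |A'| e_i⟩ is the sum over n of ⟨Q U* Y_n W* e_i, Q X_n e_i⟩;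
  -- both families have Hilbert–Schmidt square sum at most C times the trace norm of A.
  have hterm : ∀ i, ENNReal.ofReal (RCLike.re ⟪e i, opAbs A' (e i)⟫_ℂ) ≤
      ∑' n, ‖Q (ContinuousLinearMap.adjoint U (Y n (ContinuousLinearMap.adjoint W (e i))))‖ₑ *
        ‖Q (X n (e i))‖ₑ := fun i => by
    have h3 := h (e i) (ContinuousLinearMap.adjoint W (e i))
    rw [ContinuousLinearMap.adjoint_inner_left, hWA] at h3
    have h4 : ENNReal.ofReal (RCLike.re ⟪e i, opAbs A' (e i)⟫_ℂ) ≤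
        ‖⟪e i, opAbs A' (e i)⟫_ℂ‖ₑ := by
      rw [← ofReal_norm]
      exact ENNReal.ofReal_le_ofReal (RCLike.re_le_norm _)
    refine h4.trans ?_
    rw [← h3.tsum_eq]
    refine enorm_tsum_le_tsum_enorm.trans (ENNReal.tsum_le_tsum fun n => ?_)
    rw [← hUA, ← hQQ, ← ContinuousLinearMap.adjoint_inner_left, hQs, ← ofReal_norm, ← ofReal_norm,
      ← ofReal_norm, ← ENNReal.ofReal_mul (norm_nonneg _)]
    exact ENNReal.ofReal_le_ofReal (norm_inner_le_norm _ _)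
  rw [traceNorm_eq e A']
  refine (ENNReal.tsum_le_tsum hterm).trans ?_
  rw [← ENNReal.tsum_prod] at h1 h2 ⊢
  exact tsum_mul_le_of_tsum_sq_le h2 h1

end Trace

/-! ### Integral operators with kernels `Φ h` -/

section Kernel

variable {S : Type u} {T : Type v} [MeasurableSpace S] [MeasurableSpace T]

/-- Multiplication of an `L²` function by an `L^∞` function. -/
def mulL2 {m : Measure S} {φ : S → ℂ} (hφ : MemLp φ ∞ m) (f : Lp ℂ 2 m) : Lp ℂ 2 m :=
  ((Lp.memLp f).mul (r := 2) hφ).toLp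

theorem coeFn_mulL2 {m : Measure S} {φ : S → ℂ} (hφ : MemLp φ ∞ m) (f : Lp ℂ 2 m) :
    mulL2 hφ f =ᵐ[m] fun s => φ s * f s :=
  MemLp.coeFn_toLp _

theorem inner_mulL2 {m : Measure S} {φ : S → ℂ} (hφ : MemLp φ ∞ m) (f g : Lp ℂ 2 m) :
    ⟪f, mulL2 hφ g⟫_ℂ = ⟪mulL2 hφ.star f, g⟫_ℂ := by
  rw [L2.inner_def, L2.inner_def]
  refine integral_congr_ae ?_
  filter_upwards [coeFn_mulL2 hφ g, coeFn_mulL2 hφ.star f] with s h1 h2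
  rw [h1, h2]
  simp only [RCLike.inner_apply, Pi.star_apply, Complex.star_def, map_mul, Complex.conj_conj]
  ring

theorem enorm_L2_sq {m : Measure S} (f : Lp ℂ 2 m) : ‖f‖ₑ ^ 2 = ∫⁻ s, ‖f s‖ₑ ^ 2 ∂m := by
  rw [Lp.enorm_def, eLpNorm_two_sq]

theorem tsum_enorm_mulL2_sq_le {m : Measure S} {φ : ℕ → S → ℂ} (hφ : ∀ n, MemLp (φ n) ∞ m)
    {C : ℝ≥0∞} (h : ∀ᵐ s ∂m, ∑' n, ‖φ n s‖ₑ ^ 2 ≤ C) (f : Lp ℂ 2 m) :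
    ∑' n, ‖mulL2 (hφ n) f‖ₑ ^ 2 ≤ C * ‖f‖ₑ ^ 2 := by
  calc ∑' n, ‖mulL2 (hφ n) f‖ₑ ^ 2 = ∑' n, ∫⁻ s, ‖φ n s‖ₑ ^ 2 * ‖f s‖ₑ ^ 2 ∂m := by
        refine tsum_congr fun n => ?_
        rw [enorm_L2_sq]
        refine lintegral_congr_ae ?_
        filter_upwards [coeFn_mulL2 (hφ n) f] with s hs
        rw [hs, enorm_mul, mul_pow]
    _ = ∫⁻ s, ∑' n, ‖φ n s‖ₑ ^ 2 * ‖f s‖ₑ ^ 2 ∂m := by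
        exact (lintegral_tsum fun n => ((hφ n).1.enorm.pow_const 2).mul
          ((Lp.memLp f).1.enorm.pow_const 2)).symm
    _ ≤ ∫⁻ s, C * ‖f s‖ₑ ^ 2 ∂m := by
        refine lintegral_mono_ae ?_
        filter_upwards [h] with s hs
        rw [ENNReal.tsum_mul_right]
        gcongr
    _ = C * ‖f‖ₑ ^ 2 := by
        rw [lintegral_const_mul'' _ ((Lp.memLp f).1.enorm.pow_const 2), enorm_L2_sq]

theorem memLp_mul_prod {μ : Measure S} {ν : Measure T} {f : S → ℂ} {g : T → ℂ}
    (hf : MemLp f 2 μ) (hg : MemLp g 2 ν) :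
    MemLp (fun z : S × T => f z.1 * g z.2) 2 (μ.prod ν) := by
  have h1 : AEStronglyMeasurable (fun z : S × T => f z.1 * g z.2) (μ.prod ν) :=
    hf.1.comp_fst.mul hg.1.comp_snd
  rw [memLp_two_iff_integrable_sq_norm h1]
  simp only [norm_mul, mul_pow]
  exact ((memLp_two_iff_integrable_sq_norm hf.1).1 hf).mul_prod
    ((memLp_two_iff_integrable_sq_norm hg.1).1 hg)

theorem ae_tsum_enorm_star_sq_le {m : Measure S} {χ : ℕ → S → ℂ} {C : ℝ≥0∞}
    (h : ∀ᵐ s ∂m, ∑' n, ‖χ n s‖ₑ ^ 2 ≤ C) : ∀ᵐ s ∂m, ∑' n, ‖(star (χ n)) s‖ₑ ^ 2 ≤ C := by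
  simpa only [Pi.star_apply, Complex.star_def, RCLike.enorm_conj] using h

theorem integrable_kernel {μ : Measure S} {ν : Measure T} {h : S × T → ℂ}
    (hh : MemLp h 2 (μ.prod ν)) (y : Lp ℂ 2 μ) (x : Lp ℂ 2 ν) :
    Integrable (fun z : S × T => star (y z.1) * (h z * x z.2)) (μ.prod ν) := by
  have h1 := hh.integrable_mul (memLp_mul_prod (Lp.memLp y).star (Lp.memLp x))
  refine h1.congr (Filter.Eventually.of_forall fun z => ?_)
  simp only [Pi.mul_apply, Pi.star_apply]
  ring

variable {μ : Measure S} {ν : Measure T} [SFinite μ] [SFinite ν]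

theorem inner_integralOperator {h : S × T → ℂ} (hh : MemLp h 2 (μ.prod ν)) (y : Lp ℂ 2 μ)
    (x : Lp ℂ 2 ν) : ⟪y, integralOperator μ ν h hh x⟫_ℂ =
      ∫ z, star (y z.1) * (h z * x z.2) ∂μ.prod ν := by
  rw [L2.inner_def, integral_prod _ (integrable_kernel hh y x)]
  refine integral_congr_ae ?_
  filter_upwards [integralOperator_apply μ ν h hh x] with s hs
  rw [hs, integral_const_mul, RCLike.inner_apply, mul_comm]
  rfl

/-- The transformer on integral operators induced by a factorized function is bounded in the trace
norm. -/
theorem traceNorm_integralOperator_mul_le {Φ : S × T → ℂ} {φ : ℕ → S → ℂ} {ψ : ℕ → T → ℂ} {c : ℝ}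
    (hφ : ∀ n, MemLp (φ n) ∞ μ) (hψ : ∀ n, MemLp (ψ n) ∞ ν)
    (hΦ : ∀ᵐ z ∂μ.prod ν, HasSum (fun n => φ n z.1 * ψ n z.2) (Φ z))
    (hφc : ∀ᵐ s ∂μ, ∑' n, ‖φ n s‖ₑ ^ 2 ≤ ENNReal.ofReal c)
    (hψc : ∀ᵐ t ∂ν, ∑' n, ‖ψ n t‖ₑ ^ 2 ≤ ENNReal.ofReal c)
    {h : S × T → ℂ} (hh : MemLp h 2 (μ.prod ν)) (hΦh : MemLp (fun z => Φ z * h z) 2 (μ.prod ν)) :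
    traceNorm (integralOperator μ ν (fun z => Φ z * h z) hΦh) ≤
      ENNReal.ofReal c * traceNorm (integralOperator μ ν h hh) := by
  -- I_{Φh} is the weak sum of M_{φ_n} I_h M_{ψ_n}; Y_n is multiplication by conj φ_n because it
  -- acts on the other side of the inner product.
  refine traceNorm_le_of_hasSum (X := fun n => mulL2 (hψ n)) (X' := fun n => mulL2 (hψ n).star)
    (Y := fun n => mulL2 (hφ n).star) (Y' := fun n => mulL2 (hφ n).star.star)
    (fun n => inner_mulL2 (hψ n)) (fun n => inner_mulL2 (hφ n).star)
    (tsum_enorm_mulL2_sq_le _ (ae_tsum_enorm_star_sq_le hψc))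
    (tsum_enorm_mulL2_sq_le _ (ae_tsum_enorm_star_sq_le (ae_tsum_enorm_star_sq_le hφc)))
    fun x y => ?_
  simp only [inner_integralOperator]
  set G : S × T → ℂ := fun z => star (y z.1) * (h z * x z.2) with hG
  have hGi : Integrable G (μ.prod ν) := integrable_kernel hh y x
  have hF : ∀ n, AEStronglyMeasurable (fun z : S × T => φ n z.1 * ψ n z.2 * G z) (μ.prod ν) :=
    fun n => ((hφ n).1.comp_fst.mul (hψ n).1.comp_snd).mul hGi.1
  -- The sign of c is not assumed, so the dominating function uses max c 0.
  have hb : ∀ᵐ z ∂μ.prod ν, ∑' n, ‖φ n z.1 * ψ n z.2 * G z‖ₑ ≤ ‖max c 0 * ‖G z‖‖ₑ := by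
    filter_upwards [ae_tsum_enorm_mul_le hφc hψc] with z hz
    simp only [enorm_mul _ (G z), ENNReal.tsum_mul_right]
    rw [enorm_mul (max c 0), enorm_norm, Real.enorm_of_nonneg (le_max_right _ _)]
    gcongr
    exact hz.trans (ENNReal.ofReal_le_ofReal (le_max_left _ _))
  obtain ⟨-, -, hs⟩ := hasSum_integral_of_tsum_enorm_le hF (hGi.norm.const_mul (max c 0)) hb
  have h1 : ∫ z, ∑' n, φ n z.1 * ψ n z.2 * G z ∂μ.prod ν =
      ∫ z, star (y z.1) * (Φ z * h z * x z.2) ∂μ.prod ν := by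
    refine integral_congr_ae ?_
    filter_upwards [hΦ] with z hz
    rw [(hz.mul_right (G z)).tsum_eq, hG]
    ring
  rw [h1] at hs
  refine hs.congr_fun fun n => integral_congr_ae ?_
  filter_upwards [Measure.quasiMeasurePreserving_fst.ae (coeFn_mulL2 (hφ n).star y),
    Measure.quasiMeasurePreserving_snd.ae (coeFn_mulL2 (hψ n) x)] with z h2 h3
  rw [h2, h3, hG]
  simp only [Pi.star_apply, star_mul, star_star]
  ring

theorem kernelTraceNorm_mul_le {Φ : S × T → ℂ} {φ : ℕ → S → ℂ} {ψ : ℕ → T → ℂ} {c : ℝ}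
    (hΦm : AEMeasurable Φ (μ.prod ν)) (hΦc : ∀ z, ‖Φ z‖ ≤ c)
    (hφ : ∀ n, MemLp (φ n) ∞ μ) (hψ : ∀ n, MemLp (ψ n) ∞ ν)
    (hΦ : ∀ᵐ z ∂μ.prod ν, HasSum (fun n => φ n z.1 * ψ n z.2) (Φ z))
    (hφc : ∀ᵐ s ∂μ, ∑' n, ‖φ n s‖ₑ ^ 2 ≤ ENNReal.ofReal c)
    (hψc : ∀ᵐ t ∂ν, ∑' n, ‖ψ n t‖ₑ ^ 2 ≤ ENNReal.ofReal c)
    {h : S × T → ℂ} (hh : MemLp h 2 (μ.prod ν)) :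
    kernelTraceNorm μ ν (fun z => Φ z * h z) ≤ ENNReal.ofReal c * kernelTraceNorm μ ν h := by
  have hΦh : MemLp (fun z => Φ z * h z) 2 (μ.prod ν) :=
    hh.mul (r := 2) (memLp_top_of_bound hΦm.aestronglyMeasurable c
      (Filter.Eventually.of_forall hΦc))
  rw [kernelTraceNorm, kernelTraceNorm, dif_pos hΦh, dif_pos hh]
  exact traceNorm_integralOperator_mul_le hφ hψ hΦ hφc hψc hh hΦh

end Kernel

end SchurMult

end

/-! ### The theorem on measurable discrete Schur multipliers -/

theorem mainTheorem4 {S : Type*} {T : Type*} [MeasurableSpace S] [MeasurableSpace T]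
    (μ : Measure S) (ν : Measure T) [SigmaFinite μ] [SigmaFinite ν] (Φ : S × T → ℂ)
    (hΦ : SchurMult.IsDiscreteSchurMultiplier Φ) (hmeas : AEMeasurable Φ (μ.prod ν)) :
    (∃ (φ : ℕ → S → ℂ) (ψ : ℕ → T → ℂ),
      (∀ n, MemLp (φ n) ∞ μ) ∧ (∀ n, MemLp (ψ n) ∞ ν) ∧
      (∀ᵐ z ∂(μ.prod ν), HasSum (fun n => φ n z.1 * ψ n z.2) (Φ z)) ∧
      (∀ᵐ s ∂μ, ∑' n, ‖φ n s‖ₑ ^ 2 ≤ ENNReal.ofReal (SchurMult.discreteSchurNorm Φ)) ∧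
      (∀ᵐ t ∂ν, ∑' n, ‖ψ n t‖ₑ ^ 2 ≤ ENNReal.ofReal (SchurMult.discreteSchurNorm Φ))) ∧
    SchurMult.IsSchurMultiplier μ ν Φ ∧
    SchurMult.schurNorm μ ν Φ ≤ ENNReal.ofReal (SchurMult.discreteSchurNorm Φ) := by
  obtain ⟨φ, ψ, hφ, hψ, hs, h1, h2⟩ := SchurMult.exists_factorization μ ν hΦ hmeas
  have hφ' := SchurMult.memLp_top_of_tsum_enorm_sq_le hφ h1
  have hψ' := SchurMult.memLp_top_of_tsum_enorm_sq_le hψ h2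
  -- This one estimate gives both membership in 𝔐(μ, ν) and the norm bound, the norm being an
  -- infimum of such constants.
  have hle : ∀ h : S × T → ℂ, MemLp h 2 (μ.prod ν) →
      SchurMult.kernelTraceNorm μ ν (fun z => Φ z * h z) ≤
        ENNReal.ofReal (SchurMult.discreteSchurNorm Φ) * SchurMult.kernelTraceNorm μ ν h :=
    fun h hh => SchurMult.kernelTraceNorm_mul_le hmeas (SchurMult.norm_le_discreteSchurNorm hΦ)
      hφ' hψ' hs h1 h2 hh
  exact ⟨⟨φ, ψ, hφ', hψ', hs, h1, h2⟩,
    ⟨hmeas, fun h hh hfin => (hle h hh).trans_lt (ENNReal.mul_lt_top ENNReal.ofReal_lt_top hfin)⟩,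
    sInf_le hle⟩
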